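/- Let $G=GL_n(\mathbb C)$, let $B\subset G$ be the subgroup of upper triangular matrices with Lie algebra $\mathfrak b$, let $U,U^-$ be the groups of upper and lower triangular unipotent matrices, and write $g\cdot X=gXg^{-1}$. A Hessenberg space is a subspace $H\subseteq\mathfrak{gl}_n(\mathbb C)$ with $\mathfrak b\subseteq H$ and $[\mathfrak b,H]\subseteq H$; for a matrix $X$, $\mathcal H(X,H)\subseteq G/B$ is the set of cosets $gB$ with $g^{-1}\cdot X\in H$. A paving by affines of a variety $X$ is a finite ordered partition $(P_1,P_2,\dots)$ of $X$ into subvarieties isomorphic to affine spaces such that every union $\bigcup_{j\le i}P_j$ is closed in $X$. The roots are the pairs $(i,j)$, $1\le i\ne j\le n$, with root vector the matrix unit $E_{ij}$; $(i,j)$ is positive if $i<j$ (and then it is the sum of the simple roots $(k,k+1)$, $i\le k<j$). Permutations $\pi\in S_n$ are regarded as permutation matrices, with $\pi\cdot E_{ij}=E_{\pi(i)\pi(j)}$ and $\pi(i,j)=(\pi(i),\pi(j))$. For a matrix $X$ let $\Phi_X$ be the set of roots $(i,j)$ with $X_{ij}\neq0$, and for a set $\mathfrak u$ of matrices let $\Phi_{\mathfrak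 u}=\bigcup_{X\in\mathfrak u}\Phi_X$. Put $$\Phi_\pi=\{(i,j): i<j,\ \pi^{-1}(i)>\pi^{-1}(j)\},\qquad U_\pi=\{u\in U:\pi^{-1}u\pi\in U^-\},$$ $$\mathcal C(\pi\cdot H)=\{(i,j): i<j,\ E_{\pi^{-1}(i)\,\pi^{-1}(j)}\notin H\}.$$ **Theorem.** Let $M$ be a linear operator on $\mathbb C^n$. There are a basis of $\mathbb C^n$, given by the columns of some $a\in G$, and an ordering of $S_n$, both depending only on $M$, with the following properties. The matrix $M'=a^{-1}\cdot M$ of $M$ in this basis is upper triangular and its semisimple part $s$ (in the Jordan decomposition) is diagonal. For every Hessenberg space $H$, the nonempty intersections $aB\pi B/B\cap\mathcal H(M,H)$ of $\mathcal H(M,H)$ with the cells of the Bruhat decomposition $G/B=\bigsqcup_{\pi\in S_n}aB\pi B/B$ relative to this basis (the orbits of the Borel subgroup $aBa^{-1}$), in the chosen order of the $\pi$, form a paving by affines of $\mathcal H(M,H)$. The cell of $\pi$ is nonempty if and only if $\pi^{-1}\cdot M'\in H$, and in that case it is isomorphic to an affine space of dimension $$|\Phi_\pi|-|\Phi_{U_{\pi,M}\cdot(M'-s)}\cap\mathcal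 C(\pi\cdot H)|-|\Phi_\pi\cap\Phi_{\mathfrak n_M}\cap\mathcal C(\pi\cdot H)|.$$ Here $\mathfrak l_M$ is the Levi subalgebra generated by the diagonal matrices and the root spaces of $\pm\alpha$ for the simple roots $\alpha=(k,k+1)$ with $\alpha(s)=s_{kk}-s_{k+1,k+1}=0$; $\Phi_{\mathfrak n_M}$, the set of roots of the nilradical $\mathfrak n_M$ of the parabolic subalgebra $\mathfrak l_M+\mathfrak b$, consists of the positive roots that are not roots of $\mathfrak l_M$; and $U_{\pi,M}=U_\pi\cap L_M$, where $L_M$ is the Levi subgroup with Lie algebra $\mathfrak l_M$. -/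

import Mathlib

open Topology Matrix

namespace HessenbergPaving

/-! ## Varieties as spaces with functions -/

/-- A space with functions over `ℂ` on the point set `X`: a topology and, for every point `x`, the
functions that are regular in a neighbourhood of `x`. In all the instances below, whether `f` is
regular at `x` depends only on the germ of `f` at `x`; a function is regular on an open set when it
is regular at each of its points. -/
structure FunctionSpace (X : Type*) where
  top : TopologicalSpace X
  RegularAt : X → (X → ℂ) → Prop

/-- A morphism is a continuous map along which regular functions pull back to regular functions. -/
def IsMorphism {X Y : Type*} (𝒳 : FunctionSpace X) (𝒴 : FunctionSpace Y) (φ : X → Y) : Prop :=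
  Continuous[𝒳.top, 𝒴.top] φ ∧
    ∀ (x : X) (f : Y → ℂ), 𝒴.RegularAt (φ x) f → 𝒳.RegularAt x (f ∘ φ)

/-- Isomorphism of spaces with functions. -/
def Isomorphic {X Y : Type*} (𝒳 : FunctionSpace X) (𝒴 : FunctionSpace Y) : Prop :=
  ∃ e : X ≃ Y, IsMorphism 𝒳 𝒴 e ∧ IsMorphism 𝒴 𝒳 e.symm

/-- The affine space `ℂ^σ` (`σ` finite): the Zariski topology, whose basic open sets are the
non-vanishing loci of polynomials, and the functions that are locally quotients of polynomials.
(The denominator `q` may be multiplied by any polynomial that does not vanish at `x`, so that the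
condition is one on a neighbourhood of `x`.) -/
def affineSpace (σ : Type*) : FunctionSpace (σ → ℂ) where
  top := TopologicalSpace.generateFrom
    {V | ∃ p : MvPolynomial σ ℂ, V = {y | MvPolynomial.eval y p ≠ 0}}
  RegularAt x f := ∃ p q : MvPolynomial σ ℂ, MvPolynomial.eval x q ≠ 0 ∧
    ∀ y, MvPolynomial.eval y q ≠ 0 → f y = MvPolynomial.eval y p / MvPolynomial.eval y q

/-- The structure induced along an injective map `φ : X → Y` (a locally closed subset with its
reduced structure): the induced topology, and the functions that extend locally to regular functions
on `Y`. -/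
def FunctionSpace.induced {X Y : Type*} (φ : X → Y) (𝒴 : FunctionSpace Y) : FunctionSpace X where
  top := 𝒴.top.induced φ
  RegularAt x f := ∃ F : Y → ℂ, 𝒴.RegularAt (φ x) F ∧
    ∀ᶠ z in @nhds X (𝒴.top.induced φ) x, f z = F (φ z)

/-- A subset of a space with functions, with the induced structure. -/
def FunctionSpace.sub {X : Type*} (𝒳 : FunctionSpace X) (S : Set X) : FunctionSpace S :=
  𝒳.induced Subtype.val

/-- The quotient structure along a surjective map `φ : X → Y`: the quotient topology, and the
functions whose pullbacks along `φ` are regular over a neighbourhood. -/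
def FunctionSpace.quotient {X Y : Type*} (φ : X → Y) (𝒳 : FunctionSpace X) : FunctionSpace Y where
  top := 𝒳.top.coinduced φ
  RegularAt y f := ∀ᶠ z in @nhds Y (𝒳.top.coinduced φ) y,
    ∀ x, φ x = z → 𝒳.RegularAt x (f ∘ φ)

/-- `P` is a paving by affines of the subset `Y` of `𝒳`: an ordered partition of `Y` into finitely
many pieces, such that the union of each initial segment of pieces is closed in `Y`, and each piece
is isomorphic to an affine space. -/
def IsPavingByAffines {X ι : Type*} [LinearOrder ι] [Finite ι] (𝒳 : FunctionSpace X) (Y : Set X)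
    (P : ι → Set X) : Prop :=
  (⋃ i, P i) = Y ∧
  Pairwise (fun i j => Disjoint (P i) (P j)) ∧
  (∀ i, ∃ C : Set X, IsClosed[𝒳.top] C ∧ (⋃ j ≤ i, P j) = C ∩ Y) ∧
  ∀ i, ∃ d : ℕ, Isomorphic (𝒳.sub (P i)) (affineSpace (Fin d))

/-! ## The flag variety, Hessenberg varieties and Schubert cells -/

/-- The adjoint action `g · X = g X g⁻¹` of `GL_n(ℂ)` on `n × n` matrices. -/
def Ad {n : ℕ} (g : GL (Fin n) ℂ) (X : Matrix (Fin n) (Fin n) ℂ) : Matrix (Fin n) (Fin n) ℂ :=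
  (g : Matrix (Fin n) (Fin n) ℂ) * X * ((g⁻¹ : GL (Fin n) ℂ) : Matrix (Fin n) (Fin n) ℂ)

/-- The Borel subalgebra `𝔟` of upper triangular matrices. -/
def borelAlgebra (n : ℕ) : Submodule ℂ (Matrix (Fin n) (Fin n) ℂ) where
  carrier := {X | ∀ i j, j < i → X i j = 0}
  add_mem' := fun hX hY i j h => by simp [hX i j h, hY i j h]
  zero_mem' := fun _ _ _ => rfl
  smul_mem' := fun c X hX i j h => by simp [hX i j h]

/-- The Borel subgroup `B` of invertible upper triangular matrices. -/
def borelSubgroup (n : ℕ) : Subgroup (GL (Fin n) ℂ) where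
  carrier := {g | ∀ i j, j < i → (g : Matrix (Fin n) (Fin n) ℂ) i j = 0}
  mul_mem' := fun {g h} hg hh i j hij => by
    have hg' : (g : Matrix (Fin n) (Fin n) ℂ).BlockTriangular id := fun a b hab => hg a b hab
    have hh' : (h : Matrix (Fin n) (Fin n) ℂ).BlockTriangular id := fun a b hab => hh a b hab
    rw [Units.val_mul]
    exact (hg'.mul hh') hij
  one_mem' := fun i j hij => by
    rw [Units.val_one]
    exact Matrix.one_apply_ne hij.ne'
  inv_mem' := fun {g} hg i j hij => by
    have hg' : (g : Matrix (Fin n) (Fin n) ℂ).BlockTriangular id := fun a b hab => hg a b hab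
    have : Invertible (g : Matrix (Fin n) (Fin n) ℂ) := g.invertible
    rw [Matrix.coe_units_inv]
    exact (Matrix.blockTriangular_inv_of_blockTriangular hg') hij

/-- The points of the flag variety `G/B` of `G = GL_n(ℂ)`; the coset `gB` is the flag whose `k`-th
step is spanned by the first `k` columns of `g`. -/
abbrev FlagSpace (n : ℕ) : Type := GL (Fin n) ℂ ⧸ borelSubgroup n

/-- The variety structure of `GL_n(ℂ)`, as an open subset of the affine space of matrices. -/
def generalLinear (n : ℕ) : FunctionSpace (GL (Fin n) ℂ) :=
  (affineSpace (Fin n × Fin n)).induced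
    fun g p => (g : Matrix (Fin n) (Fin n) ℂ) p.1 p.2

/-- The variety structure of `G/B`, as a quotient of `G`. -/
def flagVariety (n : ℕ) : FunctionSpace (FlagSpace n) :=
  (generalLinear n).quotient QuotientGroup.mk

/-- A Hessenberg space: a `𝔟`-submodule of `𝔤𝔩_n` that contains `𝔟`. -/
def IsHessenbergSpace {n : ℕ} (H : Submodule ℂ (Matrix (Fin n) (Fin n) ℂ)) : Prop :=
  borelAlgebra n ≤ H ∧ ∀ X ∈ borelAlgebra n, ∀ Y ∈ H, ⁅X, Y⁆ ∈ H

/-- The Hessenberg variety of `X` and `H`: the image in `G/B` of `{g | g⁻¹ · X ∈ H}`. -/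
def hessenbergVariety {n : ℕ} (X : Matrix (Fin n) (Fin n) ℂ)
    (H : Submodule ℂ (Matrix (Fin n) (Fin n) ℂ)) : Set (FlagSpace n) :=
  QuotientGroup.mk '' {g : GL (Fin n) ℂ | Ad g⁻¹ X ∈ H}

/-- The permutation matrix of `π`, which sends `e_j` to `e_{π j}`. -/
def permGL {n : ℕ} (π : Equiv.Perm (Fin n)) : GL (Fin n) ℂ where
  val := Matrix.of fun i j => if i = π j then 1 else 0
  inv := Matrix.of fun i j => if π i = j then 1 else 0
  val_inv := by
    ext i j
    simp only [Matrix.mul_apply, Matrix.of_apply, Matrix.one_apply, mul_ite, mul_one, mul_zero]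
    rw [Finset.sum_eq_single (π.symm j)]
    · simp
    · intro b _ hb
      rw [if_neg]
      rintro rfl
      simp at hb
    · simp
  inv_val := by
    ext i j
    simp [Matrix.mul_apply, Matrix.one_apply]

/-- The Schubert cell of `π` in `G/B`, for the Bruhat decomposition given by the basis of `ℂ^n` that
consists of the columns of `a`. It is the orbit of the coordinate flag `aπB` under the Borel subgroup
`aBa⁻¹` of matrices that are upper triangular in that basis: `(aBa⁻¹)aπB = aBπB`. -/
def schubertCell {n : ℕ} (a : GL (Fin n) ℂ) (π : Equiv.Perm (Fin n)) : Set (FlagSpace n) :=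
  {x | ∃ b ∈ borelSubgroup n, x = QuotientGroup.mk (a * b * permGL π)}

/-! ## Roots

The root `e_i - e_j` of `𝔤𝔩_n` is written as the pair `(i, j)`, `i ≠ j`; its root space is spanned by
the matrix unit `E_ij`, it is positive when `i < j`, and a permutation `π` sends it to
`(π i, π j)`. -/

/-- `Φ_X`: the roots `(i, j)` such that `E_ij` has a nonzero coefficient in `X`. -/
def rootsOf {n : ℕ} (X : Matrix (Fin n) (Fin n) ℂ) : Set (Fin n × Fin n) :=
  {p | p.1 ≠ p.2 ∧ X p.1 p.2 ≠ 0}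

/-- `Φ_𝔲`, the union of the sets `Φ_X` for `X` in `𝔲`. -/
def rootsOfSet {n : ℕ} (𝔲 : Set (Matrix (Fin n) (Fin n) ℂ)) : Set (Fin n × Fin n) :=
  ⋃ X ∈ 𝔲, rootsOf X

/-- `Φ_π = Φ⁺ ∩ πΦ⁻`. -/
def cellRoots {n : ℕ} (π : Equiv.Perm (Fin n)) : Set (Fin n × Fin n) :=
  {p | p.1 < p.2 ∧ π⁻¹ p.2 < π⁻¹ p.1}

/-- The roots `ℳ_H` whose root space lies in `H`. -/
def hessenbergRoots {n : ℕ} (H : Submodule ℂ (Matrix (Fin n) (Fin n) ℂ)) : Set (Fin n × Fin n) :=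
  {p | p.1 ≠ p.2 ∧ Matrix.single p.1 p.2 (1 : ℂ) ∈ H}

/-- `𝒞(π·H)`: the positive roots that are not in `π ℳ_H`. -/
def complementRoots {n : ℕ} (π : Equiv.Perm (Fin n))
    (H : Submodule ℂ (Matrix (Fin n) (Fin n) ℂ)) : Set (Fin n × Fin n) :=
  {p | p.1 < p.2 ∧ (π⁻¹ p.1, π⁻¹ p.2) ∉ hessenbergRoots H}

/-- For a diagonal matrix `s`, the positive roots of the standard Levi subalgebra `𝔩` that is
generated by the diagonal matrices and the root spaces of `±α`, `α` a simple root with `α(s) = 0`.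
The simple roots that occur in `(i, j)` are the `(k, k + 1)` with `i ≤ k < j`. -/
def leviRoots {n : ℕ} (s : Matrix (Fin n) (Fin n) ℂ) : Set (Fin n × Fin n) :=
  {p | p.1 < p.2 ∧ ∀ k l : Fin n, p.1 ≤ k → l ≤ p.2 → (l : ℕ) = k + 1 → s k k - s l l = 0}

/-- The roots of the nilradical of the standard parabolic subalgebra `𝔩 + 𝔟`: the positive
roots outside `𝔩`. -/
def nilradicalRoots {n : ℕ} (s : Matrix (Fin n) (Fin n) ℂ) : Set (Fin n × Fin n) :=
  {p | p.1 < p.2 ∧ p ∉ leviRoots s}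

/-- The group `U` of upper triangular unipotent matrices. -/
def unipotents (n : ℕ) : Set (GL (Fin n) ℂ) :=
  {u | (∀ i, (u : Matrix (Fin n) (Fin n) ℂ) i i = 1) ∧
    ∀ i j, j < i → (u : Matrix (Fin n) (Fin n) ℂ) i j = 0}

/-- The opposite group `U⁻` of lower triangular unipotent matrices. -/
def oppositeUnipotents (n : ℕ) : Set (GL (Fin n) ℂ) :=
  {u | (∀ i, (u : Matrix (Fin n) (Fin n) ℂ) i i = 1) ∧
    ∀ i j, i < j → (u : Matrix (Fin n) (Fin n) ℂ) i j = 0}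

/-- `U_π = {u ∈ U | π⁻¹uπ ∈ U⁻}`. -/
def cellUnipotents {n : ℕ} (π : Equiv.Perm (Fin n)) : Set (GL (Fin n) ℂ) :=
  {u | u ∈ unipotents n ∧ (permGL π)⁻¹ * u * permGL π ∈ oppositeUnipotents n}

/-- The Levi subgroup with Lie algebra `𝔩`. -/
def leviGroup {n : ℕ} (s : Matrix (Fin n) (Fin n) ℂ) : Set (GL (Fin n) ℂ) :=
  {g | ∀ i j, i ≠ j → (i, j) ∉ leviRoots s → (j, i) ∉ leviRoots s →
    (g : Matrix (Fin n) (Fin n) ℂ) i j = 0}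

/-- `s` is the semisimple part of `X` in its Jordan decomposition. -/
def IsSemisimplePart {n : ℕ} (s X : Matrix (Fin n) (Fin n) ℂ) : Prop :=
  Module.End.IsSemisimple (Matrix.toLin' s) ∧ IsNilpotent (X - s) ∧ Commute s (X - s)

end HessenbergPaving

open HessenbergPaving

/-! Choose a basis in which the operator is X = diag(s) + N as in `IsNormalForm`: a reordered Jordan
form in which equal eigenvalues are adjacent, each row of N has at most one nonzero entry, and
within an eigenvalue block the leading entries of the rows move to the right, with zero rows last.
It follows (`IsNormalForm.isEchelon`) that for every j the first j rows of X - X_jj are in echelon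
form.

A point of the cell of π is auπB for a unique u in U_π, whose entries at Φ_π are free coordinates.
It lies in the Hessenberg variety exactly when (u⁻¹Xu)_ij = 0 for all (i, j) in C = 𝒞(π·H).
Subtracting X_jj from X does not change this entry. If row i of X - X_jj has its first nonzero entry
in a column k < j, then the entry is a nonzero constant times u_kj plus terms in coordinates from
earlier columns or from lower rows of column j (`conj_pivot_sub`). The Hessenberg condition puts (k,
j) in Φ_π, and the echelon condition makes different equations have different pivots. So the system
is triangular and can be solved for the pivot coordinates, leaving the others free
(`exists_parametrization`). If there is no such k, the equation holds identically as soon as X_ij =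
0 on C. This vanishing is necessary for a nonempty cell (`IsNormalForm.apply_eq_zero_of_conj`), and
sufficient, since u = 1 is then a solution.

The cell therefore has dimension |Φ_π| minus the number of pivot positions in C. Such a position has
s_i ≠ s_j, which gives the nilradical term, or s_i = s_j with an entry of N in row i before column
j, which gives the term with U_{π,M} (`IsNormalForm.ncard_pivotRoots`).

The parametrization is an isomorphism of varieties because the coordinates of u are ratios of
minors, regular on the translated opposite big cell aπU⁻B (`flagCoordinate`). For closedness, ranks
of lower left corners are lower semicontinuous, constant on Schubert cells, and determine π;
ordering S_n by the sum of these ranks gives closed initial unions for all a and H at once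
(`exists_closed_ordering`). -/

namespace HessenbergPaving

/-! ## Spaces with functions -/

/-- The basic properties of the regular functions on a variety: near a point they form a ring in
which functions that do not vanish at the point are invertible, regularity depends only on germs,
and non-vanishing is an open condition. -/
structure FunctionSpace.IsGeometric {X : Type*} (𝒳 : FunctionSpace X) : Prop where
  const : ∀ x c, 𝒳.RegularAt x (fun _ => c)
  add : ∀ {x f g}, 𝒳.RegularAt x f → 𝒳.RegularAt x g → 𝒳.RegularAt x (fun y => f y + g y)
  mul : ∀ {x f g}, 𝒳.RegularAt x f → 𝒳.RegularAt x g → 𝒳.RegularAt x (fun y => f y * g y)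
  inv : ∀ {x f}, 𝒳.RegularAt x f → f x ≠ 0 → 𝒳.RegularAt x (fun y => (f y)⁻¹)
  congr : ∀ {x f g}, 𝒳.RegularAt x f → (∀ᶠ y in @nhds X 𝒳.top x, g y = f y) → 𝒳.RegularAt x g
  ne_zero : ∀ {x f}, 𝒳.RegularAt x f → f x ≠ 0 → ∀ᶠ y in @nhds X 𝒳.top x, f y ≠ 0

theorem isTopologicalBasis_affineSpace (σ : Type*) :
    @TopologicalSpace.IsTopologicalBasis _ (affineSpace σ).top
      {V | ∃ p : MvPolynomial σ ℂ, V = {y | MvPolynomial.eval y p ≠ 0}} := by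
  let _ := (affineSpace σ).top
  refine ⟨?_, ?_, rfl⟩
  · rintro _ ⟨p, rfl⟩ _ ⟨q, rfl⟩ x ⟨hp, hq⟩
    refine ⟨{y | MvPolynomial.eval y (p * q) ≠ 0}, ⟨_, rfl⟩, ?_, ?_⟩
    · simpa using ⟨hp, hq⟩
    · intro y hy
      simpa [not_or] using hy
  · refine Set.eq_univ_of_forall fun x => ⟨_, ⟨1, rfl⟩, ?_⟩
    simp

theorem affineSpace_eventually_iff {σ : Type*} {x : σ → ℂ} {P : (σ → ℂ) → Prop} :
    (∀ᶠ y in @nhds _ (affineSpace σ).top x, P y) ↔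
      ∃ p : MvPolynomial σ ℂ, MvPolynomial.eval x p ≠ 0 ∧
        ∀ y, MvPolynomial.eval y p ≠ 0 → P y := by
  let _ := (affineSpace σ).top
  rw [Filter.Eventually, (isTopologicalBasis_affineSpace σ).mem_nhds_iff]
  constructor
  · rintro ⟨_, ⟨p, rfl⟩, hx, h⟩
    exact ⟨p, hx, fun y hy => h hy⟩
  · rintro ⟨p, hx, h⟩
    exact ⟨_, ⟨p, rfl⟩, hx, fun y hy => h y hy⟩

theorem affineSpace_regularAt_eval {σ : Type*} (x : σ → ℂ) (p : MvPolynomial σ ℂ) :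
    (affineSpace σ).RegularAt x (fun y => MvPolynomial.eval y p) :=
  ⟨p, 1, by simp, fun y _ => by simp⟩

theorem isGeometric_affineSpace (σ : Type*) : (affineSpace σ).IsGeometric where
  const x c := ⟨MvPolynomial.C c, 1, by simp, fun y _ => by simp⟩
  add := by
    rintro x f g ⟨p, q, hq, h⟩ ⟨p', q', hq', h'⟩
    refine ⟨p * q' + p' * q, q * q', by simpa using ⟨hq, hq'⟩, fun y hy => ?_⟩
    obtain ⟨h1, h2⟩ : MvPolynomial.eval y q ≠ 0 ∧ MvPolynomial.eval y q' ≠ 0 := by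
      simpa [not_or] using hy
    simp only [h y h1, h' y h2, map_add, map_mul]
    field_simp
  mul := by
    rintro x f g ⟨p, q, hq, h⟩ ⟨p', q', hq', h'⟩
    refine ⟨p * p', q * q', by simpa using ⟨hq, hq'⟩, fun y hy => ?_⟩
    obtain ⟨h1, h2⟩ : MvPolynomial.eval y q ≠ 0 ∧ MvPolynomial.eval y q' ≠ 0 := by
      simpa [not_or] using hy
    simp only [h y h1, h' y h2, map_mul]
    field_simp
  inv := by
    rintro x f ⟨p, q, hq, h⟩ hf
    have hp : MvPolynomial.eval x p ≠ 0 := fun h0 => hf (by rw [h x hq, h0, zero_div])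
    refine ⟨q * q, p * q, by simpa using ⟨hp, hq⟩, fun y hy => ?_⟩
    obtain ⟨h1, h2⟩ : MvPolynomial.eval y p ≠ 0 ∧ MvPolynomial.eval y q ≠ 0 := by
      simpa [not_or] using hy
    simp only [h y h2, map_mul]
    field_simp
  congr := by
    rintro x f g ⟨p, q, hq, h⟩ hfg
    obtain ⟨r, hr, hr'⟩ := affineSpace_eventually_iff.1 hfg
    refine ⟨p * r, q * r, by simpa using ⟨hq, hr⟩, fun y hy => ?_⟩
    obtain ⟨h1, h2⟩ : MvPolynomial.eval y q ≠ 0 ∧ MvPolynomial.eval y r ≠ 0 := by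
      simpa [not_or] using hy
    simp only [hr' y h2, h y h1, map_mul]
    field_simp
  ne_zero := by
    rintro x f ⟨p, q, hq, h⟩ hf
    have hp : MvPolynomial.eval x p ≠ 0 := fun h0 => hf (by rw [h x hq, h0, zero_div])
    refine affineSpace_eventually_iff.2 ⟨p * q, by simpa using ⟨hp, hq⟩, fun y hy => ?_⟩
    obtain ⟨h1, h2⟩ : MvPolynomial.eval y p ≠ 0 ∧ MvPolynomial.eval y q ≠ 0 := by
      simpa [not_or] using hy
    rw [h y h2]
    exact div_ne_zero h1 h2

theorem FunctionSpace.IsGeometric.induced {X Y : Type*} {𝒴 : FunctionSpace Y}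
    (h𝒴 : 𝒴.IsGeometric) (φ : X → Y) : (FunctionSpace.induced φ 𝒴).IsGeometric := by
  let _ := 𝒴.top
  let _ := 𝒴.top.induced φ
  have hφ : Continuous φ := continuous_induced_dom
  refine ⟨?_, ?_, ?_, ?_, ?_, ?_⟩
  · exact fun x c => ⟨fun _ => c, h𝒴.const _ c, Filter.Eventually.of_forall fun _ => rfl⟩
  · rintro x f g ⟨F, hF, hf⟩ ⟨G, hG, hg⟩
    refine ⟨_, h𝒴.add hF hG, ?_⟩
    filter_upwards [hf, hg] with y h1 h2
    rw [h1, h2]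
  · rintro x f g ⟨F, hF, hf⟩ ⟨G, hG, hg⟩
    refine ⟨_, h𝒴.mul hF hG, ?_⟩
    filter_upwards [hf, hg] with y h1 h2
    rw [h1, h2]
  · rintro x f ⟨F, hF, hf⟩ h0
    refine ⟨_, h𝒴.inv hF (by rwa [← hf.self_of_nhds]), ?_⟩
    filter_upwards [hf] with y h1
    rw [h1]
  · rintro x f g ⟨F, hF, hf⟩ hfg
    refine ⟨F, hF, ?_⟩
    filter_upwards [hf, hfg] with y h1 h2
    rw [h2, h1]
  · rintro x f ⟨F, hF, hf⟩ h0
    have h1 := hφ.continuousAt.eventually (h𝒴.ne_zero hF (by rwa [← hf.self_of_nhds]))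
    filter_upwards [hf, h1] with y h2 h3
    rwa [h2]

theorem FunctionSpace.IsGeometric.quotient {X Y : Type*} {𝒳 : FunctionSpace X}
    (h𝒳 : 𝒳.IsGeometric) (φ : X → Y) : (FunctionSpace.quotient φ 𝒳).IsGeometric := by
  let _ := 𝒳.top
  let _ := 𝒳.top.coinduced φ
  have hφ : Continuous φ := continuous_coinduced_rng
  have ne_zero : ∀ {y : Y} {f : Y → ℂ}, (FunctionSpace.quotient φ 𝒳).RegularAt y f → f y ≠ 0 →
      ∀ᶠ z in 𝓝 y, f z ≠ 0 := by
    intro y f hf h0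
    obtain ⟨V, hV, hVo, hyV⟩ := eventually_nhds_iff.1 hf
    -- Openness in the quotient is openness of the preimage, and over `V` the pullback of `f` is
    -- regular at every point.
    refine eventually_nhds_iff.2 ⟨V ∩ {z | f z ≠ 0}, fun z hz => hz.2, ?_, hyV, h0⟩
    refine isOpen_coinduced.2 (isOpen_iff_mem_nhds.2 fun x hx => ?_)
    exact Filter.inter_mem ((hVo.preimage hφ).mem_nhds hx.1)
      (h𝒳.ne_zero (hV _ hx.1 x rfl) hx.2)
  refine ⟨?_, ?_, ?_, ?_, ?_, ne_zero⟩
  · exact fun y c => Filter.Eventually.of_forall fun _ x _ => h𝒳.const x c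
  · intro y f g hf hg
    filter_upwards [hf, hg] with z h1 h2 x hx
    exact h𝒳.add (h1 x hx) (h2 x hx)
  · intro y f g hf hg
    filter_upwards [hf, hg] with z h1 h2 x hx
    exact h𝒳.mul (h1 x hx) (h2 x hx)
  · intro y f hf h0
    filter_upwards [hf, ne_zero hf h0] with z h1 h2 x hx
    subst hx
    exact h𝒳.inv (h1 x rfl) h2
  · intro y f g hf hfg
    filter_upwards [hf, hfg.eventually_nhds] with z h1 h2 x hx
    subst hx
    exact h𝒳.congr (h1 x rfl) (hφ.continuousAt.eventually h2)

theorem FunctionSpace.IsGeometric.eval {X σ : Type*} {𝒳 : FunctionSpace X} (h𝒳 : 𝒳.IsGeometric)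
    {x : X} {f : σ → X → ℂ} (hf : ∀ i, 𝒳.RegularAt x (f i)) (p : MvPolynomial σ ℂ) :
    𝒳.RegularAt x (fun y => MvPolynomial.eval (fun i => f i y) p) := by
  induction p using MvPolynomial.induction_on with
  | C c => simpa using h𝒳.const x c
  | add p q hp hq => simpa using h𝒳.add hp hq
  | mul_X p i hp => simpa using h𝒳.mul hp (hf i)

theorem FunctionSpace.IsGeometric.sum {X ι : Type*} {𝒳 : FunctionSpace X} (h𝒳 : 𝒳.IsGeometric)
    {x : X} (s : Finset ι) {f : ι → X → ℂ} (hf : ∀ i ∈ s, 𝒳.RegularAt x (f i)) :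
    𝒳.RegularAt x (fun y => ∑ i ∈ s, f i y) := by
  classical
  induction s using Finset.induction_on with
  | empty => simpa using h𝒳.const x 0
  | insert i s hi ih =>
    simpa [Finset.sum_insert hi] using h𝒳.add (hf i (Finset.mem_insert_self i s))
      (ih fun j hj => hf j (Finset.mem_insert_of_mem hj))

theorem FunctionSpace.IsGeometric.prod {X ι : Type*} {𝒳 : FunctionSpace X} (h𝒳 : 𝒳.IsGeometric)
    {x : X} (s : Finset ι) {f : ι → X → ℂ} (hf : ∀ i ∈ s, 𝒳.RegularAt x (f i)) :
    𝒳.RegularAt x (fun y => ∏ i ∈ s, f i y) := by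
  classical
  induction s using Finset.induction_on with
  | empty => simpa using h𝒳.const x 1
  | insert i s hi ih =>
    simpa [Finset.prod_insert hi] using h𝒳.mul (hf i (Finset.mem_insert_self i s))
      (ih fun j hj => hf j (Finset.mem_insert_of_mem hj))

theorem FunctionSpace.IsGeometric.det {X ι : Type*} [Fintype ι] [DecidableEq ι]
    {𝒳 : FunctionSpace X} (h𝒳 : 𝒳.IsGeometric) {x : X} {A : X → Matrix ι ι ℂ}
    (hA : ∀ i j, 𝒳.RegularAt x (fun y => A y i j)) :
    𝒳.RegularAt x (fun y => (A y).det) := by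
  simp only [Matrix.det_apply']
  exact h𝒳.sum _ fun σ _ => h𝒳.mul (h𝒳.const x _) (h𝒳.prod _ fun i _ => hA _ _)

theorem FunctionSpace.IsGeometric.matrix_mul {X ι κ μ : Type*} [Fintype κ]
    {𝒳 : FunctionSpace X} (h𝒳 : 𝒳.IsGeometric) {x : X} {A : X → Matrix ι κ ℂ}
    {A' : X → Matrix κ μ ℂ}
    (hA : ∀ i j, 𝒳.RegularAt x (fun y => A y i j))
    (hA' : ∀ i j, 𝒳.RegularAt x (fun y => A' y i j)) (i : ι) (j : μ) :
    𝒳.RegularAt x (fun y => (A y * A' y) i j) := by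
  simp only [Matrix.mul_apply]
  exact h𝒳.sum _ fun k _ => h𝒳.mul (hA _ _) (hA' _ _)

theorem isOpen_ne_zero {X : Type*} {𝒳 : FunctionSpace X} (h𝒳 : 𝒳.IsGeometric) {f : X → ℂ}
    (hf : ∀ x, 𝒳.RegularAt x f) : IsOpen[𝒳.top] {x | f x ≠ 0} := by
  let _ := 𝒳.top
  exact isOpen_iff_mem_nhds.2 fun x hx => h𝒳.ne_zero (hf x) hx

theorem IsMorphism.comp {X Y Z : Type*} {𝒳 : FunctionSpace X} {𝒴 : FunctionSpace Y}
    {𝒵 : FunctionSpace Z} {ψ : Y → Z} {φ : X → Y} (hψ : IsMorphism 𝒴 𝒵 ψ)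
    (hφ : IsMorphism 𝒳 𝒴 φ) : IsMorphism 𝒳 𝒵 (ψ ∘ φ) := by
  let _ := 𝒳.top
  let _ := 𝒴.top
  let _ := 𝒵.top
  exact ⟨Continuous.comp hψ.1 hφ.1, fun x f hf => hφ.2 x (f ∘ ψ) (hψ.2 (φ x) f hf)⟩

theorem isMorphism_quotient {X Y : Type*} (φ : X → Y) (𝒳 : FunctionSpace X) :
    IsMorphism 𝒳 (𝒳.quotient φ) φ := by
  let _ := 𝒳.top
  let _ := 𝒳.top.coinduced φ
  exact ⟨continuous_coinduced_rng, fun x f hf => hf.self_of_nhds x rfl⟩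

theorem isMorphism_induced {X Y Z : Type*} {𝒳 : FunctionSpace X} {𝒵 : FunctionSpace Z}
    (h𝒳 : 𝒳.IsGeometric) {ι : Y → Z} {φ : X → Y} (h : IsMorphism 𝒳 𝒵 (ι ∘ φ)) :
    IsMorphism 𝒳 (𝒵.induced ι) φ := by
  let _ := 𝒳.top
  let _ := 𝒵.top
  let _ := 𝒵.top.induced ι
  have hφ : Continuous φ := continuous_induced_rng.2 h.1
  refine ⟨hφ, ?_⟩
  rintro x f ⟨F, hF, hf⟩
  exact h𝒳.congr (h.2 x F hF) (hφ.continuousAt.eventually hf)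

/-- Polynomials in regular functions are regular, so basic open sets pull back to non-vanishing loci
and local quotients of polynomials pull back to regular functions. Regularity of the coordinates is
thus enough. -/
theorem isMorphism_affineSpace {X σ : Type*} {𝒳 : FunctionSpace X} (h𝒳 : 𝒳.IsGeometric)
    {φ : X → σ → ℂ} (hφ : ∀ x i, 𝒳.RegularAt x (fun y => φ y i)) :
    IsMorphism 𝒳 (affineSpace σ) φ := by
  let _ := 𝒳.top
  constructor
  · refine continuous_generateFrom_iff.2 ?_
    rintro _ ⟨p, rfl⟩
    exact isOpen_ne_zero h𝒳 fun x => h𝒳.eval (hφ x) p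
  · rintro x f ⟨p, q, hq, h⟩
    refine h𝒳.congr (h𝒳.mul (h𝒳.eval (hφ x) p) (h𝒳.inv (h𝒳.eval (hφ x) q) hq)) ?_
    filter_upwards [h𝒳.ne_zero (h𝒳.eval (hφ x) q) hq] with y hy
    rw [Function.comp_apply, h _ hy, div_eq_mul_inv]

theorem regularAt_induced {X Y : Type*} {𝒴 : FunctionSpace Y} (φ : X → Y) {x : X} {F : Y → ℂ}
    (hF : 𝒴.RegularAt (φ x) F) : (𝒴.induced φ).RegularAt x (F ∘ φ) :=
  ⟨F, hF, @Filter.Eventually.of_forall _ _ _ fun _ => rfl⟩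

/-! ## Regular functions on `GL_n` and on the flag variety -/

theorem isGeometric_generalLinear (n : ℕ) : (generalLinear n).IsGeometric :=
  (isGeometric_affineSpace _).induced _

theorem isGeometric_flagVariety (n : ℕ) : (flagVariety n).IsGeometric :=
  (isGeometric_generalLinear n).quotient _

theorem generalLinear_regularAt_apply {n : ℕ} (g : GL (Fin n) ℂ) (i j : Fin n) :
    (generalLinear n).RegularAt g fun h => (h : Matrix (Fin n) (Fin n) ℂ) i j := by
  have := affineSpace_regularAt_eval
    (fun p : Fin n × Fin n => (g : Matrix (Fin n) (Fin n) ℂ) p.1 p.2) (MvPolynomial.X (i, j))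
  simpa [Function.comp_def, generalLinear] using regularAt_induced
    (fun (g : GL (Fin n) ℂ) (p : Fin n × Fin n) => (g : Matrix (Fin n) (Fin n) ℂ) p.1 p.2) this

/-- A ratio of regular functions on `GL_n` which is constant on cosets of `B` is regular on the
flag variety where the denominator does not vanish. -/
theorem flagVariety_regularAt {n : ℕ} {N D : GL (Fin n) ℂ → ℂ} {F : FlagSpace n → ℂ}
    (hN : ∀ g, (generalLinear n).RegularAt g N) (hD : ∀ g, (generalLinear n).RegularAt g D)
    (hF : ∀ g, F (QuotientGroup.mk g) = N g / D g)
    (hDB : ∀ g, ∀ b ∈ borelSubgroup n, D g ≠ 0 → D (g * b) ≠ 0)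
    {g : GL (Fin n) ℂ} (hg : D g ≠ 0) :
    (flagVariety n).RegularAt (QuotientGroup.mk g) F := by
  let _ := (generalLinear n).top
  let _ := (flagVariety n).top
  -- The non-vanishing locus of `D` is a union of cosets of `B`, so it is the full preimage of its
  -- image, which is therefore open.
  have key : ∀ g' : GL (Fin n) ℂ,
      (QuotientGroup.mk g' : FlagSpace n) ∈ (QuotientGroup.mk : _ → FlagSpace n) '' {g | D g ≠ 0} ↔
        D g' ≠ 0 := by
    intro g'
    refine ⟨?_, fun h => ⟨g', h, rfl⟩⟩
    rintro ⟨h, hh, he⟩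
    have := hDB h _ (QuotientGroup.eq.1 he) hh
    rwa [mul_inv_cancel_left] at this
  refine eventually_nhds_iff.2 ⟨(QuotientGroup.mk : _ → FlagSpace n) '' {g | D g ≠ 0}, ?_, ?_,
    ⟨g, hg, rfl⟩⟩
  · intro z hz g' hg'
    subst hg'
    have hFm : F ∘ (QuotientGroup.mk : _ → FlagSpace n) = fun g => N g * (D g)⁻¹ := by
      funext h
      rw [Function.comp_apply, hF, div_eq_mul_inv]
    rw [hFm]
    exact (isGeometric_generalLinear n).mul (hN g')
      ((isGeometric_generalLinear n).inv (hD g') ((key g').1 hz))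
  · refine isOpen_coinduced.2 ?_
    have : (QuotientGroup.mk : _ → FlagSpace n) ⁻¹'
        ((QuotientGroup.mk : _ → FlagSpace n) '' {g | D g ≠ 0}) = {g | D g ≠ 0} :=
      Set.ext key
    rw [this]
    exact isOpen_ne_zero (isGeometric_generalLinear n) hD

/-! ## Hessenberg spaces -/

section Hessenberg

variable {n : ℕ} {H : Submodule ℂ (Matrix (Fin n) (Fin n) ℂ)}

theorem single_mem_borelAlgebra {i j : Fin n} (h : i ≤ j) (c : ℂ) :
    Matrix.single i j c ∈ borelAlgebra n := by
  intro k l hlk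
  rw [Matrix.single_apply, if_neg]
  rintro ⟨rfl, rfl⟩
  exact absurd h (not_le.2 hlk)

/-- Bracketing with E_ip and then with E_qj moves a matrix unit up and to the right. Below the
diagonal the other product in each bracket vanishes; on or above it, the unit lies in 𝔟 anyway. -/
theorem IsHessenbergSpace.single_mem (hH : IsHessenbergSpace H) {i j p q : Fin n}
    (h : Matrix.single p q (1 : ℂ) ∈ H) (hip : i ≤ p) (hqj : q ≤ j) :
    Matrix.single i j (1 : ℂ) ∈ H := by
  rcases le_or_gt i j with hij | hji
  · exact hH.1 (single_mem_borelAlgebra hij 1)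
  have h1 : Matrix.single i q (1 : ℂ) ∈ H := by
    rcases eq_or_lt_of_le hip with rfl | hlt
    · exact h
    have := hH.2 _ (single_mem_borelAlgebra hip 1) _ h
    rwa [Ring.lie_def, Matrix.single_mul_single_same,
      Matrix.single_mul_single_of_ne _ _ _ _ (hqj.trans_lt hji).ne, sub_zero, one_mul] at this
  rcases eq_or_lt_of_le hqj with rfl | hlt
  · exact h1
  have := hH.2 _ (single_mem_borelAlgebra hqj 1) _ h1
  rw [Ring.lie_def, Matrix.single_mul_single_same,
      Matrix.single_mul_single_of_ne _ _ _ _ hji.ne, zero_sub, one_mul] at this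
  exact neg_mem_iff.1 this

/-- Stability under the diagonal matrices makes `H` a span of matrix units. For q < p the double
bracket with E_qq and E_pp isolates the entries (p, q) and (q, p), and the latter belongs to 𝔟. -/
theorem IsHessenbergSpace.mem_iff (hH : IsHessenbergSpace H) {X : Matrix (Fin n) (Fin n) ℂ} :
    X ∈ H ↔ ∀ p q, X p q ≠ 0 → Matrix.single p q (1 : ℂ) ∈ H := by
  constructor
  · intro hX p q hpq
    rcases le_or_gt p q with h | h
    · exact hH.1 (single_mem_borelAlgebra h 1)
    have h1 := hH.2 _ (single_mem_borelAlgebra (le_refl p) 1) _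
      (hH.2 _ (single_mem_borelAlgebra (le_refl q) 1) _ hX)
    have h2 : ⁅Matrix.single p p (1 : ℂ), ⁅Matrix.single q q (1 : ℂ), X⁆⁆ =
        - (X p q • Matrix.single p q (1 : ℂ) + X q p • Matrix.single q p (1 : ℂ)) := by
      simp only [Ring.lie_def, mul_sub, sub_mul, ← mul_assoc]
      rw [Matrix.single_mul_single_of_ne _ _ _ _ h.ne', mul_assoc X,
        Matrix.single_mul_single_of_ne _ _ _ _ h.ne, Matrix.single_mul_mul_single,
        Matrix.single_mul_mul_single, Matrix.smul_single, Matrix.smul_single]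
      simp only [smul_eq_mul, one_mul, mul_one, zero_mul, mul_zero]
      abel
    rw [h2, neg_mem_iff] at h1
    have h3 := (H.add_mem_iff_left
      (H.smul_mem _ (hH.1 (single_mem_borelAlgebra h.le 1)))).1 h1
    exact (H.smul_mem_iff hpq).1 h3
  · intro h
    rw [Matrix.matrix_eq_sum_single X]
    refine H.sum_mem fun p _ => H.sum_mem fun q _ => ?_
    by_cases hpq : X p q = 0
    · simp [hpq]
    · have := H.smul_mem (X p q) (h p q hpq)
      simpa using this

/-- Each entry of the product only involves entries of `X` weakly below and to the left of it. This
passes from stability under 𝔟 to stability under the group `B`. -/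
theorem IsHessenbergSpace.conj_mem (hH : IsHessenbergSpace H) {X b b' : Matrix (Fin n) (Fin n) ℂ}
    (hX : X ∈ H) (hb : b ∈ borelAlgebra n) (hb' : b' ∈ borelAlgebra n) : b * X * b' ∈ H := by
  refine hH.mem_iff.2 fun i j hij => ?_
  rw [Matrix.mul_apply] at hij
  obtain ⟨q, -, hq⟩ := Finset.exists_ne_zero_of_sum_ne_zero hij
  rw [Matrix.mul_apply, Finset.sum_mul] at hq
  obtain ⟨p, -, hpq⟩ := Finset.exists_ne_zero_of_sum_ne_zero hq
  have hp := left_ne_zero_of_mul hpq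
  have h1 : i ≤ p := not_lt.1 fun h => left_ne_zero_of_mul hp (hb _ _ h)
  have h2 : q ≤ j := not_lt.1 fun h => right_ne_zero_of_mul hpq (hb' _ _ h)
  exact hH.single_mem (hH.mem_iff.1 hX _ _ (right_ne_zero_of_mul hp)) h1 h2

theorem Ad_mul (g h : GL (Fin n) ℂ) (X : Matrix (Fin n) (Fin n) ℂ) :
    Ad (g * h) X = Ad g (Ad h X) := by
  simp [Ad, mul_assoc]

theorem mk_mem_hessenbergVariety (hH : IsHessenbergSpace H) {X : Matrix (Fin n) (Fin n) ℂ}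
    {g : GL (Fin n) ℂ} :
    (QuotientGroup.mk g : FlagSpace n) ∈ hessenbergVariety X H ↔ Ad g⁻¹ X ∈ H := by
  refine ⟨?_, fun h => ⟨g, h, rfl⟩⟩
  rintro ⟨h, hh, he⟩
  have hb := QuotientGroup.eq.1 he
  have : g⁻¹ = (h⁻¹ * g)⁻¹ * h⁻¹ := by group
  rw [this, Ad_mul]
  refine hH.conj_mem hh ((borelSubgroup n).inv_mem hb) ?_
  rw [inv_inv]
  exact hb

theorem Ad_permGL_inv_apply (π : Equiv.Perm (Fin n)) (X : Matrix (Fin n) (Fin n) ℂ)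
    (p q : Fin n) : Ad (permGL π)⁻¹ X p q = X (π p) (π q) := by
  have : ((permGL π)⁻¹ : GL (Fin n) ℂ).val = Matrix.of fun i j => if π i = j then 1 else 0 := rfl
  have h2 : (permGL π).val = Matrix.of fun i j => if i = π j then 1 else 0 := rfl
  simp [Ad, this, h2, Matrix.mul_apply]

/-- Entries of an upper triangular `X` below the diagonal are zero and diagonal ones are harmless,
so only positive roots impose conditions. -/
theorem IsHessenbergSpace.Ad_permGL_inv_mem_iff (hH : IsHessenbergSpace H)
    {π : Equiv.Perm (Fin n)} {X : Matrix (Fin n) (Fin n) ℂ} (hX : X ∈ borelAlgebra n) :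
    Ad (permGL π)⁻¹ X ∈ H ↔ ∀ p ∈ complementRoots π H, X p.1 p.2 = 0 := by
  rw [hH.mem_iff]
  constructor
  · rintro h ⟨i, j⟩ ⟨hij, hC⟩
    by_contra h0
    refine hC ⟨by simpa using hij.ne, h _ _ ?_⟩
    simpa [Ad_permGL_inv_apply] using h0
  · intro h p q hpq
    rw [Ad_permGL_inv_apply] at hpq
    have hle : π p ≤ π q := not_lt.1 fun h => hpq (hX _ _ h)
    rcases eq_or_lt_of_le hle with he | hlt
    · rw [π.injective he]
      exact hH.1 (single_mem_borelAlgebra le_rfl 1)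
    · by_contra h1
      exact hpq (h (π p, π q) ⟨hlt, fun h2 => h1 (by simpa using h2.2)⟩)

theorem complementRoots_subset_cellRoots (hH : IsHessenbergSpace H) (π : Equiv.Perm (Fin n)) :
    complementRoots π H ⊆ cellRoots π := by
  rintro ⟨i, j⟩ ⟨hij, hC⟩
  refine ⟨hij, not_le.1 fun h => hC ⟨by simpa using hij.ne, ?_⟩⟩
  exact hH.1 (single_mem_borelAlgebra h 1)

/-- If `(i, j)` is in the complement of `π · H` but `(i, l)` is not, `(l, j)` is in `Φ_π`. -/
theorem mem_cellRoots_of_complementRoots (hH : IsHessenbergSpace H) {π : Equiv.Perm (Fin n)}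
    {i j l : Fin n} (hij : (i, j) ∈ complementRoots π H) (hil : (i, l) ∉ complementRoots π H)
    (h : i < l) (hlj : l < j) : (l, j) ∈ cellRoots π := by
  refine ⟨hlj, not_le.1 fun hle => hij.2 ⟨by simpa using hij.1.ne, ?_⟩⟩
  have : (π⁻¹ i, π⁻¹ l) ∈ hessenbergRoots H := by
    by_contra h1
    exact hil ⟨h, h1⟩
  exact hH.single_mem this.2 le_rfl hle

end Hessenberg

/-! ## Triangular systems of polynomial equations -/

/-- Substitution `x_w = G_w(x)` for `w ∈ D`, and free variables otherwise. -/
noncomputable def substitution {V : Type*} (D : Set V) (G : V → MvPolynomial V ℂ) :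
    ℕ → V → MvPolynomial {w // w ∉ D} ℂ
  -- A default value: `m` is the number of iterations, and after `m` of them the variables of rank
  -- below `m` have stabilized.
  | 0, _ => 0
  | m + 1, w => by
    classical
    exact if h : w ∈ D then MvPolynomial.bind₁ (substitution D G m) (G w) else MvPolynomial.X ⟨w, h⟩

theorem eval_substitution_succ {V : Type*} (D : Set V) (G : V → MvPolynomial V ℂ) (m : ℕ) {w : V}
    (hw : w ∈ D) (y : {w // w ∉ D} → ℂ) :
    MvPolynomial.eval y (substitution D G (m + 1) w) =
      MvPolynomial.eval (fun v => MvPolynomial.eval y (substitution D G m v)) (G w) := by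
  rw [substitution, dif_pos hw, MvPolynomial.eval, MvPolynomial.eval₂Hom_bind₁]
  rfl

theorem eval_substitution_of_notMem {V : Type*} (D : Set V) (G : V → MvPolynomial V ℂ) (m : ℕ)
    (w : {w // w ∉ D}) (y : {w // w ∉ D} → ℂ) :
    MvPolynomial.eval y (substitution D G (m + 1) w) = y w := by
  rw [substitution, dif_neg w.2, MvPolynomial.eval_X]

/-- A triangular system of polynomial equations `x_w = G_w(x)`, `w ∈ D`, is solved by polynomials
in the free variables. -/
theorem exists_triangular_solution {V : Type*} [Finite V] (r : V → ℕ) (D : Set V)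
    (G : V → MvPolynomial V ℂ)
    (hG : ∀ w ∈ D, ∀ x x' : V → ℂ, (∀ v, r v < r w → x v = x' v) →
      MvPolynomial.eval x (G w) = MvPolynomial.eval x' (G w)) :
    ∃ Q : V → MvPolynomial {w // w ∉ D} ℂ,
      (∀ y (w : {w // w ∉ D}), MvPolynomial.eval y (Q w) = y w) ∧
      (∀ y, ∀ w ∈ D, MvPolynomial.eval y (Q w) =
        MvPolynomial.eval (fun v => MvPolynomial.eval y (Q v)) (G w)) ∧
      ∀ x : V → ℂ, (∀ w ∈ D, x w = MvPolynomial.eval x (G w)) →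
        ∀ v, MvPolynomial.eval (fun w : {w // w ∉ D} => x w) (Q v) = x v := by
  obtain ⟨B, hB⟩ := (Set.finite_range r).bddAbove
  have hB' : ∀ w, r w < B + 1 := fun w => Nat.lt_succ_of_le (hB ⟨w, rfl⟩)
  -- `G w` only sees variables of smaller rank, whose values no longer change; hence after more
  -- iterations than the largest rank all equations hold. Uniqueness below is the same induction.
  have stable : ∀ m w, r w < m → ∀ y, MvPolynomial.eval y (substitution D G (m + 1) w) =
      MvPolynomial.eval y (substitution D G m w) := by
    intro m
    induction m with
    | zero => exact fun w hw => absurd hw (Nat.not_lt_zero _)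
    | succ m ih =>
      intro w hw y
      by_cases hD : w ∈ D
      · rw [eval_substitution_succ _ _ _ hD, eval_substitution_succ _ _ _ hD]
        exact hG w hD _ _ fun v hv => ih v (by omega) y
      · exact (eval_substitution_of_notMem D G _ ⟨w, hD⟩ y).trans
          (eval_substitution_of_notMem D G _ ⟨w, hD⟩ y).symm
  have sol : ∀ y, ∀ w ∈ D, MvPolynomial.eval y (substitution D G (B + 1) w) =
      MvPolynomial.eval (fun v => MvPolynomial.eval y (substitution D G (B + 1) v)) (G w) := by
    intro y w hw
    rw [← eval_substitution_succ _ _ _ hw, stable _ _ (hB' w)]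
  refine ⟨substitution D G (B + 1), fun y w => eval_substitution_of_notMem D G B w y, sol, ?_⟩
  intro x hx
  suffices ∀ m v, r v < m →
      MvPolynomial.eval (fun w : {w // w ∉ D} => x w) (substitution D G (B + 1) v) = x v from
    fun v => this _ v (Nat.lt_succ_self _)
  intro m
  induction m with
  | zero => exact fun w hw => absurd hw (Nat.not_lt_zero _)
  | succ m ih =>
    intro v hv
    by_cases hD : v ∈ D
    · rw [sol _ v hD, hx v hD]
      exact hG v hD _ _ fun w hw => ih w (by omega)
    · exact eval_substitution_of_notMem D G _ ⟨v, hD⟩ _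

/-! ## Unipotent matrices with given coordinates -/

/-- The matrix in `U_π` with coordinates `x`. -/
noncomputable def cellMatrix {n : ℕ} (π : Equiv.Perm (Fin n)) {R : Type*} [CommRing R]
    (x : cellRoots π → R) : Matrix (Fin n) (Fin n) R := by
  classical
  exact Matrix.of fun i j =>
    if i = j then 1 else if h : (i, j) ∈ cellRoots π then x ⟨(i, j), h⟩ else 0

section cellMatrix

variable {n : ℕ} {π : Equiv.Perm (Fin n)} {R : Type*} [CommRing R]

theorem cellMatrix_self (x : cellRoots π → R) (i : Fin n) : cellMatrix π x i i = 1 := by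
  simp [cellMatrix]

theorem cellMatrix_mem (x : cellRoots π → R) (p : cellRoots π) :
    cellMatrix π x p.1.1 p.1.2 = x p := by
  have h : p.1.1 ≠ p.1.2 := p.2.1.ne
  simp [cellMatrix, h]

theorem cellMatrix_of_notMem (x : cellRoots π → R) {i j : Fin n} (h : i ≠ j)
    (hij : (i, j) ∉ cellRoots π) : cellMatrix π x i j = 0 := by
  simp [cellMatrix, h, hij]

theorem cellMatrix_of_lt (x : cellRoots π → R) {i j : Fin n} (h : j < i) :
    cellMatrix π x i j = 0 :=
  cellMatrix_of_notMem x h.ne' fun h' => absurd h'.1 h.asymm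

theorem map_cellMatrix {S : Type*} [CommRing S] (f : R →+* S) (x : cellRoots π → R) :
    f.mapMatrix (cellMatrix π x) = cellMatrix π (f ∘ x) := by
  ext i j
  simp only [cellMatrix, RingHom.mapMatrix_apply, Matrix.map_apply, Matrix.of_apply]
  split_ifs <;> simp

theorem det_cellMatrix (x : cellRoots π → R) : (cellMatrix π x).det = 1 := by
  have h : (cellMatrix π x).BlockTriangular id := fun i j hij => cellMatrix_of_lt x hij
  rw [Matrix.det_of_isUpperTriangular h]
  exact Finset.prod_eq_one fun i _ => cellMatrix_self x i

/-- As the determinant is 1, the adjugate is the inverse; it expresses the entries of u⁻¹ as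
polynomials in the coordinates of u, over any ring. -/
theorem adjugate_mul_cellMatrix (x : cellRoots π → R) :
    (cellMatrix π x).adjugate * cellMatrix π x = 1 := by
  rw [Matrix.adjugate_mul, det_cellMatrix, one_smul]

theorem cellMatrix_congr {x x' : cellRoots π → R} {i j : Fin n}
    (h : ∀ p : cellRoots π, p.1 = (i, j) → x p = x' p) :
    cellMatrix π x i j = cellMatrix π x' i j := by
  by_cases hij : i = j
  · subst hij
    rw [cellMatrix_self, cellMatrix_self]
  by_cases hp : (i, j) ∈ cellRoots π
  · exact (cellMatrix_mem x ⟨_, hp⟩).trans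
      ((h ⟨_, hp⟩ rfl).trans (cellMatrix_mem x' ⟨_, hp⟩).symm)
  · rw [cellMatrix_of_notMem x hij hp, cellMatrix_of_notMem x' hij hp]

end cellMatrix

/-! ## Conjugation by unipotent upper triangular matrices -/

/-- A matrix is upper unipotent. -/
structure IsUpperUnipotent {n : ℕ} (u : Matrix (Fin n) (Fin n) ℂ) : Prop where
  diag : ∀ i, u i i = 1
  upper : ∀ i j, j < i → u i j = 0

section Unipotent

variable {n : ℕ} {u v u' v' A : Matrix (Fin n) (Fin n) ℂ}

theorem isUpperUnipotent_cellMatrix {π : Equiv.Perm (Fin n)} (x : cellRoots π → ℂ) :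
    IsUpperUnipotent (cellMatrix π x) :=
  ⟨cellMatrix_self x, fun _ _ h => cellMatrix_of_lt x h⟩

theorem mul_apply_self_of_upper {X Y : Matrix (Fin n) (Fin n) ℂ} (hX : X ∈ borelAlgebra n)
    (hY : Y ∈ borelAlgebra n) (i : Fin n) : (X * Y) i i = X i i * Y i i := by
  rw [Matrix.mul_apply]
  refine Finset.sum_eq_single i (fun k _ hk => ?_) (by simp)
  rcases lt_or_gt_of_ne hk with h | h
  · rw [hX _ _ h, zero_mul]
  · rw [hY _ _ h, mul_zero]

theorem mul_mem_borelAlgebra {X Y : Matrix (Fin n) (Fin n) ℂ} (hX : X ∈ borelAlgebra n)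
    (hY : Y ∈ borelAlgebra n) : X * Y ∈ borelAlgebra n := by
  intro i j hij
  have hX' : X.BlockTriangular id := fun a b hab => hX a b hab
  have hY' : Y.BlockTriangular id := fun a b hab => hY a b hab
  exact (hX'.mul hY') hij

theorem IsUpperUnipotent.of_mul_eq_one (hu : IsUpperUnipotent u) (h : v * u = 1) :
    IsUpperUnipotent v := by
  have hu' : u.BlockTriangular id := fun a b hab => hu.upper a b hab
  have hv : v = u⁻¹ := (Matrix.inv_eq_left_inv h).symm
  let _ : Invertible u := Matrix.invertibleOfIsUnitDet u (Matrix.isUnit_det_of_left_inverse h)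
  have hv' : v ∈ borelAlgebra n := by
    rw [hv]
    exact fun a b hab => (Matrix.blockTriangular_inv_of_blockTriangular hu') hab
  refine ⟨fun i => ?_, hv'⟩
  have := mul_apply_self_of_upper hv' hu.upper i
  rwa [h, Matrix.one_apply_eq, hu.diag, mul_one, eq_comm] at this

theorem IsUpperUnipotent.mulVec_apply (hv : IsUpperUnipotent v) {w : Fin n → ℂ} {i : Fin n}
    (hw : ∀ k, i < k → w k = 0) : ∑ k, v i k * w k = w i := by
  rw [Finset.sum_eq_single i]
  · rw [hv.diag, one_mul]
  · intro k _ hk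
    rcases lt_or_gt_of_ne hk with h | h
    · rw [hv.upper _ _ h, zero_mul]
    · rw [hw _ h, mul_zero]
  · simp

/-- This is why X_jj is subtracted: column j of the product then lives strictly above row j. -/
theorem mul_apply_eq_zero_of_upper (hA : A ∈ borelAlgebra n) (hu : u ∈ borelAlgebra n)
    {j k : Fin n} (hAj : A j j = 0) (hjk : j ≤ k) : (A * u) k j = 0 := by
  rcases eq_or_lt_of_le hjk with rfl | h
  · rw [mul_apply_self_of_upper hA hu, hAj, zero_mul]
  · exact mul_mem_borelAlgebra hA hu _ _ h

/-- If column `j` of `Au` vanishes below row `i`, its entry in row `i` is that of `u⁻¹Au`. -/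
theorem conj_apply (hv : IsUpperUnipotent v) {i j : Fin n}
    (h : ∀ k, i < k → (A * u) k j = 0) : (v * A * u) i j = (A * u) i j := by
  rw [mul_assoc, Matrix.mul_apply]
  exact hv.mulVec_apply (w := fun k => (A * u) k j) h

/-- From v' - v = v(u - u')v': the middle factor vanishes in the columns before j, and v' is upper
triangular. So these columns of the inverse depend only on the same columns of u. -/
theorem inv_apply_congr (hv' : v' ∈ borelAlgebra n) (h : v * u = 1) (h' : v' * u' = 1)
    {j : Fin n} (hu : ∀ k l, l < j → u k l = u' k l) (i : Fin n) {k : Fin n} (hk : k < j) :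
    v i k = v' i k := by
  have h1 : v' - v = v * (u - u') * v' := by
    rw [mul_sub, sub_mul, h, one_mul, mul_assoc, mul_eq_one_comm.1 h', mul_one]
  have h2 : (v' - v) i k = 0 := by
    rw [h1, mul_assoc, Matrix.mul_apply]
    refine Finset.sum_eq_zero fun a _ => ?_
    rw [Matrix.mul_apply, Finset.sum_eq_zero, mul_zero]
    intro b _
    rcases lt_or_ge b j with hb | hb
    · rw [Matrix.sub_apply, hu _ _ hb, sub_self, zero_mul]
    · rw [hv' _ _ (hk.trans_le hb), mul_zero]
  exact (sub_eq_zero.1 h2).symm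

/-- How an entry of `u⁻¹Au` changes when the columns of `u` from the `j`-th on are changed. -/
theorem conj_apply_sub (hu : IsUpperUnipotent u) (hu' : IsUpperUnipotent u') (h : v * u = 1)
    (h' : v' * u' = 1) (hA : A ∈ borelAlgebra n) {i j : Fin n} (hAj : A j j = 0)
    (huu' : ∀ k l, l < j → u k l = u' k l)
    (hi : ∀ k, i < k → (A * u) k j = (A * u') k j) :
    (v * A * u) i j - (v' * A * u') i j = (A * u) i j - (A * u') i j := by
  have hv := hu.of_mul_eq_one h
  have hv' := hu'.of_mul_eq_one h'
  rw [mul_assoc, mul_assoc, Matrix.mul_apply, Matrix.mul_apply, ← Finset.sum_sub_distrib]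
  rw [← hv.mulVec_apply (w := fun k => (A * u) k j - (A * u') k j)
    fun k hk => sub_eq_zero.2 (hi k hk)]
  refine Finset.sum_congr rfl fun k _ => ?_
  -- For k < j the two inverses have the same entry (i, k); for k ≥ j column j of both products
  -- vanishes in row k.
  rcases lt_or_ge k j with hk | hk
  · rw [inv_apply_congr hv'.upper h h' huu' i hk, mul_sub]
  · rw [mul_apply_eq_zero_of_upper hA hu.upper hAj hk,
      mul_apply_eq_zero_of_upper hA hu'.upper hAj hk, sub_zero, mul_zero, mul_zero, sub_zero]

theorem conj_sub_scalar_apply (h : v * u = 1) (X : Matrix (Fin n) (Fin n) ℂ) (c : ℂ)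
    {i j : Fin n} (hij : i ≠ j) :
    (v * (X - c • (1 : Matrix (Fin n) (Fin n) ℂ)) * u) i j = (v * X * u) i j := by
  rw [mul_sub, sub_mul, Matrix.mul_smul, mul_one, Matrix.smul_mul, h, Matrix.sub_apply,
    Matrix.smul_apply, Matrix.one_apply_ne hij, smul_zero, sub_zero]

end Unipotent

/-! ## The equations of the cells -/

/-- The matrix `X - X_jj`. -/
noncomputable def shift {n : ℕ} (X : Matrix (Fin n) (Fin n) ℂ) (j : Fin n) :
    Matrix (Fin n) (Fin n) ℂ :=
  X - X j j • (1 : Matrix (Fin n) (Fin n) ℂ)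

/-- An upper triangular matrix `X` such that, for all `j`, the first nonzero entries of the first
`j` rows of `X - X_jj` lie in increasing columns. -/
structure IsEchelon {n : ℕ} (X : Matrix (Fin n) (Fin n) ℂ) : Prop where
  upper : X ∈ borelAlgebra n
  echelon : ∀ {i i' j l : Fin n}, i < i' → i' < j → shift X j i' l ≠ 0 →
    ∃ k < l, shift X j i k ≠ 0

/-- The positions `(i, j)` in `C` such that `X - X_jj` has a nonzero entry in row `i` before the
`j`-th column. -/
def pivotRoots {n : ℕ} (X : Matrix (Fin n) (Fin n) ℂ) (C : Set (Fin n × Fin n)) :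
    Set (Fin n × Fin n) :=
  {p | p ∈ C ∧ ∃ k < p.2, shift X p.2 p.1 k ≠ 0}

section equations

variable {n : ℕ} {X : Matrix (Fin n) (Fin n) ℂ}

theorem shift_mem_borelAlgebra (hX : X ∈ borelAlgebra n) (j : Fin n) :
    shift X j ∈ borelAlgebra n := by
  intro k l h
  rw [shift, Matrix.sub_apply, hX _ _ h, Matrix.smul_apply, Matrix.one_apply_ne h.ne', smul_zero,
    sub_zero]

theorem shift_apply_self (X : Matrix (Fin n) (Fin n) ℂ) (j : Fin n) : shift X j j j = 0 := by
  simp [shift]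

theorem shift_apply_of_ne (X : Matrix (Fin n) (Fin n) ℂ) (j : Fin n) {k l : Fin n} (h : k ≠ l) :
    shift X j k l = X k l := by
  simp [shift, Matrix.one_apply_ne h]

theorem exists_pivot {C : Set (Fin n × Fin n)} {p : Fin n × Fin n} (hp : p ∈ pivotRoots X C) :
    ∃ k < p.2, shift X p.2 p.1 k ≠ 0 ∧ ∀ l < k, shift X p.2 p.1 l = 0 := by
  obtain ⟨-, k, hk, hk0⟩ := hp
  obtain ⟨m, hm, hmin⟩ := Set.exists_min_image {l | shift X p.2 p.1 l ≠ 0} id (Set.toFinite _)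
    ⟨k, hk0⟩
  exact ⟨m, (hmin k hk0).trans_lt hk, hm,
    fun l hl => by_contra fun h0 => absurd (hmin l h0) (not_le.2 hl)⟩

/-- The column of the first nonzero entry in row `i` of `X - X_jj`. -/
noncomputable def pivot {C : Set (Fin n × Fin n)} (p : pivotRoots X C) : Fin n :=
  (exists_pivot p.2).choose

theorem pivot_lt {C : Set (Fin n × Fin n)} (p : pivotRoots X C) : pivot p < p.1.2 :=
  (exists_pivot p.2).choose_spec.1

theorem shift_pivot {C : Set (Fin n × Fin n)} (p : pivotRoots X C) :
    shift X p.1.2 p.1.1 (pivot p) ≠ 0 :=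
  (exists_pivot p.2).choose_spec.2.1

theorem shift_of_lt_pivot {C : Set (Fin n × Fin n)} (p : pivotRoots X C) {l : Fin n}
    (h : l < pivot p) : shift X p.1.2 p.1.1 l = 0 :=
  (exists_pivot p.2).choose_spec.2.2 l h

/-- A pivot on the diagonal gives back (i, j), which is in Φ_π. Otherwise X_ik ≠ 0 keeps (i, k) out
of the complement, and the Hessenberg condition forces (k, j) into Φ_π. So the pivot names an actual
coordinate of U_π. -/
theorem pivot_mem_cellRoots {H : Submodule ℂ (Matrix (Fin n) (Fin n) ℂ)}
    (hH : IsHessenbergSpace H) {π : Equiv.Perm (Fin n)} (hX : IsEchelon X)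
    (hXC : ∀ p ∈ complementRoots π H, X p.1 p.2 = 0) (p : pivotRoots X (complementRoots π H)) :
    (pivot p, p.1.2) ∈ cellRoots π := by
  have h0 := shift_pivot p
  have hle : p.1.1 ≤ pivot p :=
    not_lt.1 fun h => h0 (shift_mem_borelAlgebra hX.upper _ _ _ h)
  rcases eq_or_lt_of_le hle with h | h
  · rw [← h]
    exact complementRoots_subset_cellRoots hH π p.2.1
  · refine mem_cellRoots_of_complementRoots hH p.2.1 (fun hmem => h0 ?_) h (pivot_lt p)
    rw [shift_apply_of_ne _ _ h.ne]
    exact hXC _ hmem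

/-- For fixed j the echelon condition gives distinct rows distinct pivots; hence distinct equations
are solved for distinct coordinates. -/
theorem pivot_injective {C : Set (Fin n × Fin n)} (hC : ∀ p ∈ C, p.1 < p.2) (hX : IsEchelon X)
    {p q : pivotRoots X C} (h : pivot p = pivot q) (h2 : p.1.2 = q.1.2) : p = q := by
  have aux : ∀ p q : pivotRoots X C, pivot p = pivot q → p.1.2 = q.1.2 → ¬ p.1.1 < q.1.1 := by
    intro p q h h2 hlt
    obtain ⟨k, hk, hk0⟩ := hX.echelon hlt (hC _ q.2.1) (shift_pivot q)
    rw [← h2] at hk0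
    exact hk0 (shift_of_lt_pivot p (h ▸ hk))
  refine Subtype.ext (Prod.ext ?_ h2)
  exact le_antisymm (not_lt.1 (aux q p h.symm h2.symm)) (not_lt.1 (aux p q h h2))

/-- Rows between i and j start after the pivot by the echelon condition, and rows from j on by
triangularity, since the pivot is before column j. -/
theorem IsEchelon.lt_of_shift_ne_zero {C : Set (Fin n × Fin n)} (hX : IsEchelon X)
    (p : pivotRoots X C) {k l : Fin n} (hk : p.1.1 < k) (h : shift X p.1.2 k l ≠ 0) :
    pivot p < l := by
  rcases lt_or_ge k p.1.2 with hkj | hkj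
  · obtain ⟨k', hk', h0⟩ := hX.echelon hk hkj h
    exact (not_lt.1 fun h1 => h0 (shift_of_lt_pivot p h1)).trans_lt hk'
  · refine (pivot_lt p).trans_le (hkj.trans ?_)
    exact not_lt.1 fun h1 => h (shift_mem_borelAlgebra hX.upper _ _ _ h1)

/-- The entry `(i, j)` of `u⁻¹Xu` as a polynomial in the coordinates of `u ∈ U_π`. -/
noncomputable def conjPolynomial (π : Equiv.Perm (Fin n)) (X : Matrix (Fin n) (Fin n) ℂ)
    (p : Fin n × Fin n) : MvPolynomial (cellRoots π) ℂ :=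
  ((cellMatrix π MvPolynomial.X).adjugate * X.map MvPolynomial.C *
    cellMatrix π MvPolynomial.X : Matrix (Fin n) (Fin n) (MvPolynomial (cellRoots π) ℂ)) p.1 p.2

theorem eval_conjPolynomial (π : Equiv.Perm (Fin n)) (p : Fin n × Fin n) (x : cellRoots π → ℂ) :
    MvPolynomial.eval x (conjPolynomial π X p) =
      ((cellMatrix π x).adjugate * X * cellMatrix π x) p.1 p.2 := by
  have h1 : (MvPolynomial.eval x).mapMatrix (cellMatrix π MvPolynomial.X) = cellMatrix π x := by
    rw [map_cellMatrix]
    congr 1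
    funext p
    simp
  have h2 : (MvPolynomial.eval x).mapMatrix (X.map MvPolynomial.C) = X := by
    ext i j
    simp
  have h3 : (MvPolynomial.eval x).mapMatrix ((cellMatrix π MvPolynomial.X).adjugate *
      X.map MvPolynomial.C * cellMatrix π MvPolynomial.X) =
      (cellMatrix π x).adjugate * X * cellMatrix π x := by
    rw [map_mul, map_mul, RingHom.map_adjugate, h1, h2]
  rw [← h3]
  rfl

theorem conj_shift_apply {π : Equiv.Perm (Fin n)} (x : cellRoots π → ℂ) {i j : Fin n}
    (h : i ≠ j) :
    ((cellMatrix π x).adjugate * shift X j * cellMatrix π x) i j =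
      ((cellMatrix π x).adjugate * X * cellMatrix π x) i j :=
  conj_sub_scalar_apply (adjugate_mul_cellMatrix x) X _ h

/-- Changing the coordinate at the pivot, and later coordinates, changes the entry linearly. -/
theorem conj_pivot_sub {π : Equiv.Perm (Fin n)} {C : Set (Fin n × Fin n)}
    (hC : ∀ p ∈ C, p.1 < p.2) (hX : IsEchelon X) (p : pivotRoots X C) {x x' : cellRoots π → ℂ}
    (hcol : ∀ w : cellRoots π, w.1.2 < p.1.2 → x w = x' w)
    (hrow : ∀ w : cellRoots π, w.1.2 = p.1.2 → pivot p < w.1.1 → x w = x' w) :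
    ((cellMatrix π x).adjugate * X * cellMatrix π x) p.1.1 p.1.2 -
      ((cellMatrix π x').adjugate * X * cellMatrix π x') p.1.1 p.1.2 =
    shift X p.1.2 p.1.1 (pivot p) *
      (cellMatrix π x (pivot p) p.1.2 - cellMatrix π x' (pivot p) p.1.2) := by
  have hlater : ∀ l, pivot p < l → cellMatrix π x l p.1.2 = cellMatrix π x' l p.1.2 :=
    fun l hl => cellMatrix_congr fun w hw => hrow w (by rw [hw]) (by rw [hw]; exact hl)
  have hne := (hC _ p.2.1).ne
  rw [← conj_shift_apply x hne, ← conj_shift_apply x' hne]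
  rw [conj_apply_sub (isUpperUnipotent_cellMatrix x) (isUpperUnipotent_cellMatrix x')
    (adjugate_mul_cellMatrix x) (adjugate_mul_cellMatrix x') (shift_mem_borelAlgebra hX.upper _)
    (shift_apply_self X _)]
  · rw [Matrix.mul_apply, Matrix.mul_apply, ← Finset.sum_sub_distrib,
      Finset.sum_eq_single (pivot p), mul_sub]
    -- Left of the pivot row i is zero, right of it the coordinates agree, so only the pivot term
    -- survives.
    · intro l _ hl
      rcases lt_or_gt_of_ne hl with h | h
      · rw [shift_of_lt_pivot p h, zero_mul, zero_mul, sub_zero]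
      · rw [hlater l h, sub_self]
    · simp
  · exact fun k l hl => cellMatrix_congr fun w hw => hcol w (by rw [hw]; exact hl)
  · intro k hk
    rw [Matrix.mul_apply, Matrix.mul_apply]
    refine Finset.sum_congr rfl fun l _ => ?_
    by_cases h0 : shift X p.1.2 k l = 0
    · rw [h0, zero_mul, zero_mul]
    · rw [hlater l (hX.lt_of_shift_ne_zero p hk h0)]

/-- Without a pivot, row i of X - X_jj vanishes through column j, and by the echelon condition so do
the rows between i and j. Column j of (X - X_jj)u is then zero from row i on, and multiplying by u⁻¹
keeps entry (i, j) zero. -/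
theorem conj_eq_zero_of_notMem_pivotRoots {π : Equiv.Perm (Fin n)} {C : Set (Fin n × Fin n)}
    (hC : ∀ p ∈ C, p.1 < p.2) (hX : IsEchelon X) (hXC : ∀ p ∈ C, X p.1 p.2 = 0)
    {p : Fin n × Fin n} (hp : p ∈ C) (hpp : p ∉ pivotRoots X C) (x : cellRoots π → ℂ) :
    ((cellMatrix π x).adjugate * X * cellMatrix π x) p.1 p.2 = 0 := by
  have hu := isUpperUnipotent_cellMatrix x
  have hlt := hC p hp
  have h0 : ∀ l ≤ p.2, shift X p.2 p.1 l = 0 := by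
    intro l hl
    rcases eq_or_lt_of_le hl with rfl | h
    · rw [shift_apply_of_ne _ _ hlt.ne, hXC _ hp]
    · by_contra h1
      exact hpp ⟨hp, l, h, h1⟩
  have h1 : ∀ k, p.1 ≤ k → (shift X p.2 * cellMatrix π x) k p.2 = 0 := by
    intro k hk
    rcases lt_or_ge k p.2 with hkj | hkj
    · rw [Matrix.mul_apply]
      refine Finset.sum_eq_zero fun l _ => ?_
      rcases lt_or_ge p.2 l with hl | hl
      · rw [hu.upper _ _ hl, mul_zero]
      · rcases eq_or_lt_of_le hk with h | h
        · rw [← h, h0 l hl, zero_mul]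
        · by_contra h2
          obtain ⟨k', hk', h3⟩ := hX.echelon h hkj (left_ne_zero_of_mul h2)
          exact h3 (h0 k' (hk'.le.trans hl))
    · exact mul_apply_eq_zero_of_upper (shift_mem_borelAlgebra hX.upper _) hu.upper
        (shift_apply_self X _) hkj
  rw [← conj_shift_apply x hlt.ne,
    conj_apply (hu.of_mul_eq_one (adjugate_mul_cellMatrix x)) fun k hk => h1 k hk.le]
  exact h1 _ le_rfl

/-- The coordinates of the points of `U_π` with `u⁻¹Xu ∈ π · H` are polynomials in a subset of
the coordinates, which can be chosen freely. -/
theorem exists_parametrization {H : Submodule ℂ (Matrix (Fin n) (Fin n) ℂ)}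
    (hH : IsHessenbergSpace H) {π : Equiv.Perm (Fin n)} (hX : IsEchelon X)
    (hXC : ∀ p ∈ complementRoots π H, X p.1 p.2 = 0) :
    ∃ (D : Set (cellRoots π)) (Q : cellRoots π → MvPolynomial {w // w ∉ D} ℂ),
      D.ncard = (pivotRoots X (complementRoots π H)).ncard ∧
      (∀ y (w : {w // w ∉ D}), MvPolynomial.eval y (Q w) = y w) ∧
      (∀ y, ∀ p ∈ complementRoots π H,
        ((cellMatrix π fun w => MvPolynomial.eval y (Q w)).adjugate * X *
          cellMatrix π fun w => MvPolynomial.eval y (Q w)) p.1 p.2 = 0) ∧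
      ∀ x : cellRoots π → ℂ, (∀ p ∈ complementRoots π H,
          ((cellMatrix π x).adjugate * X * cellMatrix π x) p.1 p.2 = 0) →
        ∀ v, MvPolynomial.eval (fun w : {w // w ∉ D} => x w) (Q v) = x v := by
  classical
  set C := complementRoots π H with hCdef
  have hC : ∀ p ∈ C, p.1 < p.2 := fun p hp => hp.1
  let f : pivotRoots X C → cellRoots π := fun p =>
    ⟨(pivot p, p.1.2), pivot_mem_cellRoots hH hX hXC p⟩
  have hf : Function.Injective f := fun p q h =>
    pivot_injective hC hX (congrArg (fun w => w.1.1) h) (congrArg (fun w => w.1.2) h)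
  have hfval : ∀ (p) (x : cellRoots π → ℂ), cellMatrix π x (pivot p) p.1.2 = x (f p) :=
    fun p x => cellMatrix_mem x (f p)
  -- The equation at `p` solved for its pivot coordinate: dividing the entry by the pivot and
  -- subtracting it cancels that coordinate.
  let G : cellRoots π → MvPolynomial (cellRoots π) ℂ := fun w =>
    if h : w ∈ Set.range f then
      MvPolynomial.X w - MvPolynomial.C (shift X h.choose.1.2 h.choose.1.1 (pivot h.choose))⁻¹ *
        conjPolynomial π X h.choose.1
    else 0
  have hGf : ∀ p x, MvPolynomial.eval x (G (f p)) = x (f p) -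
      (shift X p.1.2 p.1.1 (pivot p))⁻¹ *
        ((cellMatrix π x).adjugate * X * cellMatrix π x) p.1.1 p.1.2 := by
    intro p x
    have h : f p ∈ Set.range f := ⟨p, rfl⟩
    have h' : h.choose = p := hf h.choose_spec
    simp only [G, dif_pos h, map_sub, map_mul, MvPolynomial.eval_X, MvPolynomial.eval_C,
      eval_conjPolynomial, h']
  have heq : ∀ p x, x (f p) = MvPolynomial.eval x (G (f p)) ↔
      ((cellMatrix π x).adjugate * X * cellMatrix π x) p.1.1 p.1.2 = 0 := by
    intro p x
    rw [hGf, eq_comm, sub_eq_self, mul_eq_zero]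
    exact or_iff_right (inv_ne_zero (shift_pivot p))
  -- Coordinates are ranked by columns, and within a column from bottom to top. Since n - k lies
  -- between 1 and n, every coordinate in an earlier column has smaller rank.
  let r : cellRoots π → ℕ := fun w => w.1.2 * n + (n - w.1.1)
  obtain ⟨Q, h1, h2, h3⟩ := exists_triangular_solution r (Set.range f) G (by
    rintro _ ⟨p, rfl⟩ x x' hx
    have key := conj_pivot_sub hC hX p (x := x) (x' := x')
      (fun w hw => hx w (by
        have : (w.1.2 : ℕ) + 1 ≤ p.1.2 := hw
        have h4 := Nat.mul_le_mul_right n this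
        have h5 := (pivot p).2
        simp only [r, f]
        rw [add_mul, one_mul] at h4
        omega))
      (fun w hw hw' => hx w (by
        have h4 : (pivot p : ℕ) < w.1.1 := hw'
        have h5 := w.1.1.2
        simp only [r, f, hw]
        omega))
    rw [hfval, hfval] at key
    rw [hGf, hGf]
    have h0 := shift_pivot p
    field_simp
    linear_combination -key)
  refine ⟨Set.range f, Q, ?_, h1, ?_, ?_⟩
  · rw [← Set.image_univ, Set.ncard_image_of_injective _ hf, Set.ncard_univ, Nat.card_coe_set_eq]
  · intro y p hp
    by_cases hpp : p ∈ pivotRoots X C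
    · exact (heq ⟨p, hpp⟩ _).1 (h2 y _ ⟨⟨p, hpp⟩, rfl⟩)
    · exact conj_eq_zero_of_notMem_pivotRoots hC hX hXC hp hpp _
  · intro x hx
    refine h3 x ?_
    rintro _ ⟨p, rfl⟩
    exact (heq p x).2 (hx _ p.2.1)

end equations

/-! ## The group `U_π` -/

section cellGL

variable {n : ℕ} {π : Equiv.Perm (Fin n)}

/-- The element of `U_π` with coordinates `x`. -/
noncomputable def cellGL (π : Equiv.Perm (Fin n)) (x : cellRoots π → ℂ) : GL (Fin n) ℂ where
  val := cellMatrix π x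
  inv := (cellMatrix π x).adjugate
  val_inv := by rw [Matrix.mul_adjugate, det_cellMatrix, one_smul]
  inv_val := adjugate_mul_cellMatrix x

theorem coe_cellGL (x : cellRoots π → ℂ) :
    (cellGL π x : Matrix (Fin n) (Fin n) ℂ) = cellMatrix π x := rfl

theorem cellGL_mem_borelSubgroup (x : cellRoots π → ℂ) : cellGL π x ∈ borelSubgroup n :=
  fun _ _ h => cellMatrix_of_lt x h

theorem permGL_conj_apply (u : GL (Fin n) ℂ) (p q : Fin n) :
    ((permGL π)⁻¹ * u * permGL π : GL (Fin n) ℂ).val p q = u.val (π p) (π q) := by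
  have := Ad_permGL_inv_apply π u.val p q
  rwa [Ad, inv_inv] at this

theorem cellGL_mem_cellUnipotents (x : cellRoots π → ℂ) : cellGL π x ∈ cellUnipotents π := by
  refine ⟨⟨cellMatrix_self x, fun i j h => cellMatrix_of_lt x h⟩, fun i => ?_, fun i j h => ?_⟩
  · rw [permGL_conj_apply]
    exact cellMatrix_self x _
  · rw [permGL_conj_apply]
    refine cellMatrix_of_notMem x (π.injective.ne h.ne) fun h' => ?_
    have := h'.2
    simp only [Equiv.Perm.coe_inv, Equiv.symm_apply_apply] at this
    exact absurd this h.asymm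

theorem eq_cellGL_of_mem {u : GL (Fin n) ℂ} (hu : u ∈ cellUnipotents π) :
    u = cellGL π fun p => u.val p.1.1 p.1.2 := by
  refine Units.ext (Matrix.ext fun i j => ?_)
  rw [coe_cellGL]
  rcases eq_or_ne i j with rfl | hij
  · rw [cellMatrix_self, hu.1.1]
  by_cases h : (i, j) ∈ cellRoots π
  · exact (cellMatrix_mem (fun p : cellRoots π => u.val p.1.1 p.1.2) ⟨_, h⟩).symm
  rw [cellMatrix_of_notMem _ hij h]
  rcases lt_or_gt_of_ne hij with h1 | h1
  · have h2 : π⁻¹ i < π⁻¹ j :=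
      lt_of_le_of_ne (not_lt.1 fun h2 => h ⟨h1, h2⟩) (π⁻¹.injective.ne hij)
    have := hu.2.2 _ _ h2
    rwa [permGL_conj_apply, Equiv.Perm.coe_inv, Equiv.apply_symm_apply,
      Equiv.apply_symm_apply] at this
  · exact hu.1.2 _ _ h1

/-- The condition is that π⁻¹ · (u⁻¹ · M') lies in `H`. As u⁻¹ · M' is upper triangular, only its
entries at 𝒞(π·H) matter. -/
theorem mk_cellGL_mem_hessenbergVariety {H : Submodule ℂ (Matrix (Fin n) (Fin n) ℂ)}
    (hH : IsHessenbergSpace H) {M : Matrix (Fin n) (Fin n) ℂ} {a : GL (Fin n) ℂ}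
    (hM : Ad a⁻¹ M ∈ borelAlgebra n) (x : cellRoots π → ℂ) :
    (QuotientGroup.mk (a * cellGL π x * permGL π) : FlagSpace n) ∈ hessenbergVariety M H ↔
      ∀ p ∈ complementRoots π H,
        ((cellMatrix π x).adjugate * Ad a⁻¹ M * cellMatrix π x) p.1 p.2 = 0 := by
  have hu := isUpperUnipotent_cellMatrix x
  have hv := hu.of_mul_eq_one (adjugate_mul_cellMatrix x)
  rw [mk_mem_hessenbergVariety hH, _root_.mul_inv_rev, _root_.mul_inv_rev, Ad_mul, Ad_mul]
  have h : Ad (cellGL π x)⁻¹ (Ad a⁻¹ M) =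
      (cellMatrix π x).adjugate * Ad a⁻¹ M * cellMatrix π x := by
    rw [Ad, inv_inv]
    rfl
  rw [h, hH.Ad_permGL_inv_mem_iff]
  exact mul_mem_borelAlgebra (mul_mem_borelAlgebra hv.upper hM) hu.upper

end cellGL

/-! ## Matrices in normal form -/

/-- A diagonal matrix with eigenvalues `s` and a commuting nilpotent matrix `N` in echelon form:
equal eigenvalues are adjacent, `N` is strictly upper triangular with at most one nonzero entry in
each row, and within the block of an eigenvalue the zero rows of `N` come last, and the nonzero
entries of the other rows lie in increasing columns. -/
structure IsNormalForm {n : ℕ} (s : Fin n → ℂ) (N : Matrix (Fin n) (Fin n) ℂ) : Prop where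
  convex : ∀ {i j k : Fin n}, i ≤ j → j ≤ k → s i = s k → s i = s j
  eq : ∀ {i j : Fin n}, N i j ≠ 0 → s i = s j
  lt : ∀ {i j : Fin n}, N i j ≠ 0 → i < j
  unique : ∀ {i j j' : Fin n}, N i j ≠ 0 → N i j' ≠ 0 → j = j'
  echelon : ∀ {i i' l : Fin n}, i < i' → s i = s i' → N i' l ≠ 0 → ∃ k < l, N i k ≠ 0

namespace IsNormalForm

variable {n : ℕ} {s : Fin n → ℂ} {N : Matrix (Fin n) (Fin n) ℂ}

theorem mem_borelAlgebra (h : IsNormalForm s N) : diagonal s + N ∈ borelAlgebra n := by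
  intro i j hij
  rw [Matrix.add_apply, Matrix.diagonal_apply_ne _ hij.ne', zero_add]
  by_contra h0
  exact hij.asymm (h.lt h0)

theorem add_apply_self (h : IsNormalForm s N) (i : Fin n) : (diagonal s + N) i i = s i := by
  rw [Matrix.add_apply, Matrix.diagonal_apply_eq, add_eq_left]
  by_contra h0
  exact (h.lt h0).ne rfl

theorem add_apply_of_ne (s : Fin n → ℂ) (N : Matrix (Fin n) (Fin n) ℂ) {i j : Fin n}
    (hij : i ≠ j) : (diagonal s + N) i j = N i j := by
  rw [Matrix.add_apply, Matrix.diagonal_apply_ne _ hij, zero_add]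

theorem shift_self (h : IsNormalForm s N) (j i : Fin n) :
    shift (diagonal s + N) j i i = s i - s j := by
  simp [shift, h.add_apply_self]

theorem shift_of_ne (s : Fin n → ℂ) (N : Matrix (Fin n) (Fin n) ℂ) (j : Fin n) {i k : Fin n}
    (hik : i ≠ k) : shift (diagonal s + N) j i k = N i k := by
  rw [shift_apply_of_ne _ _ hik, add_apply_of_ne _ _ hik]

/-- If s_i ≠ s_j, the diagonal entry s_i - s_j of row i precedes everything in row i'. If they are
equal, i' belongs to the same eigenvalue block and the echelon condition on N applies. -/
theorem isEchelon (h : IsNormalForm s N) : IsEchelon (diagonal s + N) where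
  upper := h.mem_borelAlgebra
  echelon := by
    intro i i' j l hii' hi'j h0
    have hl : i' ≤ l := not_lt.1 fun h1 => h0 (shift_mem_borelAlgebra h.mem_borelAlgebra _ _ _ h1)
    by_cases hs : s i = s j
    · have hs' := h.convex hii'.le hi'j.le hs
      have hne : i' ≠ l := by
        rintro rfl
        rw [h.shift_self, ← hs', hs, sub_self] at h0
        exact h0 rfl
      rw [shift_of_ne _ _ _ hne] at h0
      obtain ⟨k, hk, hk0⟩ := h.echelon hii' hs' h0
      exact ⟨k, hk, by rwa [shift_of_ne _ _ _ (h.lt hk0).ne]⟩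
    · exact ⟨i, hii'.trans_le hl, by rwa [h.shift_self, sub_ne_zero]⟩

/-- If the normal form is conjugate to an element of `π · H` under `U`, it lies in `π · H`. -/
theorem apply_eq_zero_of_conj (h : IsNormalForm s N) {u v : Matrix (Fin n) (Fin n) ℂ}
    (hu : IsUpperUnipotent u) (huv : v * u = 1) {i j : Fin n} (hij : i < j)
    (h0 : (v * (diagonal s + N) * u) i j = 0) : (diagonal s + N) i j = 0 := by
  by_contra hN
  rw [add_apply_of_ne _ _ hij.ne] at hN
  have hs := h.eq hN
  -- Since s_i = s_j and N_ij is the only entry of N in its row, row i of X - X_jj starts in column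
  -- j. Lower rows start even later, so conjugation cannot change the entry N_ij.
  have hrow : ∀ l < j, shift (diagonal s + N) j i l = 0 := by
    intro l hl
    rcases eq_or_ne i l with rfl | hil
    · rw [h.shift_self, hs, sub_self]
    · rw [shift_of_ne _ _ _ hil]
      by_contra h1
      exact hl.ne (h.unique h1 hN)
  rw [← conj_sub_scalar_apply huv _ ((diagonal s + N) j j) hij.ne, ← shift,
    conj_apply (hu.of_mul_eq_one huv), Matrix.mul_apply, Finset.sum_eq_single j, hu.diag,
    mul_one, shift_of_ne _ _ _ hij.ne] at h0
  · exact hN h0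
  · intro l _ hl
    rcases lt_or_gt_of_ne hl with h1 | h1
    · rw [hrow l h1, zero_mul]
    · rw [hu.upper _ _ h1, mul_zero]
  · simp
  · intro k hk
    rcases lt_or_ge k j with hkj | hkj
    · rw [Matrix.mul_apply]
      refine Finset.sum_eq_zero fun l _ => ?_
      rcases lt_or_ge j l with hl | hl
      · rw [hu.upper _ _ hl, mul_zero]
      · by_contra h1
        obtain ⟨k', hk', h2⟩ := h.isEchelon.echelon hk hkj (left_ne_zero_of_mul h1)
        exact h2 (hrow k' (hk'.trans_le hl))
    · exact mul_apply_eq_zero_of_upper (shift_mem_borelAlgebra h.mem_borelAlgebra _) hu.upper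
        (shift_apply_self _ _) hkj

/-- Equal eigenvalues are adjacent, so s is constant along the simple roots of (i, j) exactly when
it agrees at the ends. Hence the Levi subgroup is the centralizer of s. -/
theorem mem_leviRoots (h : IsNormalForm s N) {p : Fin n × Fin n} :
    p ∈ leviRoots (diagonal s) ↔ p.1 < p.2 ∧ s p.1 = s p.2 := by
  refine and_congr_right fun hlt => ⟨fun hp => ?_, fun hs k l hk hl hkl => ?_⟩
  · have : ∀ (m : ℕ) (hm : m < n), p.1 ≤ ⟨m, hm⟩ → (⟨m, hm⟩ : Fin n) ≤ p.2 →
        s p.1 = s ⟨m, hm⟩ := by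
      intro m
      induction m with
      | zero =>
        intro hm h1 _
        congr 1
        exact le_antisymm h1 (Fin.le_def.2 (Nat.zero_le _))
      | succ m ih =>
        intro hm h1 h2
        rcases eq_or_lt_of_le h1 with h3 | h3
        · rw [← h3]
        have hm' : m < n := by omega
        have h4 : p.1 ≤ ⟨m, hm'⟩ := Nat.le_of_lt_succ h3
        have h5 : (⟨m, hm'⟩ : Fin n) ≤ p.2 := Nat.le_of_succ_le h2
        rw [ih hm' h4 h5]
        simpa [sub_eq_zero] using hp ⟨m, hm'⟩ ⟨m + 1, hm⟩ h4 h2 rfl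
    exact this p.2 p.2.2 hlt.le le_rfl
  · have hkl' : k ≤ l := Fin.le_def.2 (by omega)
    rw [Matrix.diagonal_apply_eq, Matrix.diagonal_apply_eq,
      ← h.convex hk (hkl'.trans hl) hs, ← h.convex (hk.trans hkl') hl hs, sub_self]

theorem mem_nilradicalRoots (h : IsNormalForm s N) {p : Fin n × Fin n} :
    p ∈ nilradicalRoots (diagonal s) ↔ p.1 < p.2 ∧ s p.1 ≠ s p.2 := by
  refine and_congr_right fun hlt => ?_
  rw [h.mem_leviRoots]
  exact ⟨fun h1 h2 => h1 ⟨hlt, h2⟩, fun h1 h2 => h1 h2.2⟩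

theorem mem_leviGroup (h : IsNormalForm s N) {g : GL (Fin n) ℂ} :
    g ∈ leviGroup (diagonal s) ↔ Commute (g : Matrix (Fin n) (Fin n) ℂ) (diagonal s) := by
  have h1 : Commute (g : Matrix (Fin n) (Fin n) ℂ) (diagonal s) ↔
      ∀ i j, s i ≠ s j → (g : Matrix (Fin n) (Fin n) ℂ) i j = 0 := by
    rw [commute_iff_eq, ← Matrix.ext_iff]
    refine forall_congr' fun i => forall_congr' fun j => ?_
    rw [Matrix.mul_diagonal, Matrix.diagonal_mul, ← sub_eq_zero, mul_comm, ← sub_mul,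
      mul_eq_zero, sub_eq_zero]
    tauto
  rw [h1]
  refine forall_congr' fun i => forall_congr' fun j => ?_
  simp only [h.mem_leviRoots]
  constructor
  · intro h2 hs
    exact h2 (fun h3 => hs (congrArg s h3)) (fun h3 => hs h3.2) (fun h3 => hs h3.2.symm)
  · intro h2 hij h3 h4
    refine h2 fun hs => ?_
    rcases lt_or_gt_of_ne hij with h5 | h5
    · exact h3 ⟨h5, hs⟩
    · exact h4 ⟨h5, hs.symm⟩

theorem apply_eq_zero_of_mem_leviGroup (h : IsNormalForm s N) {g : GL (Fin n) ℂ}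
    (hg : g ∈ leviGroup (diagonal s)) {i j : Fin n} (hs : s i ≠ s j) :
    (g : Matrix (Fin n) (Fin n) ℂ) i j = 0 := by
  have := congrFun (congrFun (h.mem_leviGroup.1 hg) i) j
  rw [Matrix.mul_diagonal, Matrix.diagonal_mul, ← sub_eq_zero, mul_comm, ← sub_mul,
    mul_eq_zero, sub_eq_zero] at this
  exact this.resolve_left hs.symm

theorem inv_mem_leviGroup (h : IsNormalForm s N) {g : GL (Fin n) ℂ}
    (hg : g ∈ leviGroup (diagonal s)) : g⁻¹ ∈ leviGroup (diagonal s) :=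
  h.mem_leviGroup.2 (h.mem_leviGroup.1 hg).units_inv_left

variable {H : Submodule ℂ (Matrix (Fin n) (Fin n) ℂ)} {π : Equiv.Perm (Fin n)}

/-- A nonzero entry (i, j) of uNu⁻¹ comes from some N_kl with i ≤ k and l ≤ j in the same eigenvalue
block. The echelon condition yields a nonzero entry of row i at or before l, and it is not at j
because N_ij = 0. Conversely, u = 1 + E_kj produces -N_ik at (i, j). -/
theorem mem_rootsOfSet (h : IsNormalForm s N) (hH : IsHessenbergSpace H)
    (hC : ∀ p ∈ complementRoots π H, (diagonal s + N) p.1 p.2 = 0) {p : Fin n × Fin n}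
    (hp : p ∈ complementRoots π H) :
    p ∈ rootsOfSet ((fun u => Ad u N) '' (cellUnipotents π ∩ leviGroup (diagonal s))) ↔
      s p.1 = s p.2 ∧ ∃ k < p.2, N p.1 k ≠ 0 := by
  obtain ⟨i, j⟩ := p
  have hij : i < j := hp.1
  have hN0 : N i j = 0 := by
    rw [← add_apply_of_ne s N hij.ne]
    exact hC _ hp
  simp only [rootsOfSet, Set.mem_iUnion, exists_prop]
  constructor
  · rintro ⟨_, ⟨u, ⟨hu, huL⟩, rfl⟩, -, h0⟩
    have huv := h.inv_mem_leviGroup huL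
    have hv : u⁻¹ ∈ borelSubgroup n := (borelSubgroup n).inv_mem hu.1.2
    replace h0 : (u.val * N * u⁻¹.val) i j ≠ 0 := h0
    rw [mul_assoc, Matrix.mul_apply] at h0
    obtain ⟨k, -, hk⟩ := Finset.exists_ne_zero_of_sum_ne_zero h0
    have hk2 := right_ne_zero_of_mul hk
    rw [Matrix.mul_apply] at hk2
    obtain ⟨l, -, hl⟩ := Finset.exists_ne_zero_of_sum_ne_zero hk2
    have hik : i ≤ k := not_lt.1 fun h1 => left_ne_zero_of_mul hk (hu.1.2 _ _ h1)
    have hlj : l ≤ j := not_lt.1 fun h1 => right_ne_zero_of_mul hl (hv _ _ h1)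
    have s1 : s i = s k := by
      by_contra h1
      exact left_ne_zero_of_mul hk (h.apply_eq_zero_of_mem_leviGroup huL h1)
    have s2 : s l = s j := by
      by_contra h1
      exact right_ne_zero_of_mul hl (h.apply_eq_zero_of_mem_leviGroup huv h1)
    have hkl := left_ne_zero_of_mul hl
    refine ⟨s1.trans ((h.eq hkl).trans s2), ?_⟩
    obtain ⟨m, hm, hm0⟩ : ∃ m ≤ l, N i m ≠ 0 := by
      rcases eq_or_lt_of_le hik with rfl | hlt
      · exact ⟨l, le_rfl, hkl⟩
      · obtain ⟨m, hm, hm0⟩ := h.echelon hlt s1 hkl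
        exact ⟨m, hm.le, hm0⟩
    refine ⟨m, lt_of_le_of_ne (hm.trans hlj) ?_, hm0⟩
    rintro rfl
    exact hm0 hN0
  · rintro ⟨hs, k, hk, hk0⟩
    have hik := h.lt hk0
    have hkj : (k, j) ∈ cellRoots π := by
      refine mem_cellRoots_of_complementRoots hH hp (fun h1 => hk0 ?_) hik hk
      rw [← add_apply_of_ne s N hik.ne]
      exact hC _ h1
    classical
    -- The coordinates of u = 1 + E_kj; it commutes with s because s_k = s_i = s_j.
    let x : cellRoots π → ℂ := Pi.single ⟨(k, j), hkj⟩ 1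
    have hx : ∀ a b, a ≠ b → (a, b) ≠ (k, j) → cellMatrix π x a b = 0 := by
      intro a b hab hne
      by_cases hmem : (a, b) ∈ cellRoots π
      · rw [cellMatrix_mem x ⟨_, hmem⟩]
        exact Pi.single_eq_of_ne (fun h1 => hne (congrArg Subtype.val h1)) _
      · exact cellMatrix_of_notMem x hab hmem
    have hxkj : cellMatrix π x k j = 1 := by
      rw [cellMatrix_mem x ⟨_, hkj⟩]
      exact Pi.single_eq_same _ _
    have hu := isUpperUnipotent_cellMatrix x
    have hv := hu.of_mul_eq_one (adjugate_mul_cellMatrix x)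
    have hvkj : (cellMatrix π x).adjugate k j = -1 := by
      have h1 := congrFun (congrFun (adjugate_mul_cellMatrix x) k) j
      rw [Matrix.one_apply_ne hk.ne, Matrix.mul_apply, Finset.sum_eq_add k j hk.ne] at h1
      · rw [hv.diag, hu.diag, hxkj] at h1
        linear_combination h1
      · rintro l - ⟨hlk, hlj⟩
        rw [hx l j hlj (fun h2 => hlk (congrArg Prod.fst h2)), mul_zero]
      · simp
      · simp
    refine ⟨_, ⟨cellGL π x, ⟨cellGL_mem_cellUnipotents x, ?_⟩, rfl⟩, hij.ne, ?_⟩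
    · rw [h.mem_leviGroup, commute_iff_eq]
      ext a b
      rw [Matrix.mul_diagonal, Matrix.diagonal_mul, coe_cellGL, mul_comm]
      rcases eq_or_ne a b with rfl | hab
      · rfl
      · by_cases he : (a, b) = (k, j)
        · obtain ⟨rfl, rfl⟩ := Prod.mk.inj he
          rw [← hs, h.eq hk0]
        · rw [hx a b hab he, mul_zero, mul_zero]
    · change (cellMatrix π x * N * (cellMatrix π x).adjugate) i j ≠ 0
      rw [mul_assoc, Matrix.mul_apply, Finset.sum_eq_single i, hu.diag, one_mul, Matrix.mul_apply,
        Finset.sum_eq_single k, hvkj]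
      · simpa using hk0
      · intro l _ hl
        by_contra h1
        exact hl (h.unique (left_ne_zero_of_mul h1) hk0)
      · simp
      · intro l _ hl
        rw [hx i l hl.symm (fun h2 => hik.ne (congrArg Prod.fst h2)), zero_mul]
      · simp

/-- If s_i ≠ s_j, the diagonal already supplies a nonzero entry before column j; if s_i = s_j, only
N can. The two cases are disjoint and give the two subtracted terms. -/
theorem ncard_pivotRoots (h : IsNormalForm s N) (hH : IsHessenbergSpace H)
    (hC : ∀ p ∈ complementRoots π H, (diagonal s + N) p.1 p.2 = 0) :
    (pivotRoots (diagonal s + N) (complementRoots π H)).ncard =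
      (rootsOfSet ((fun u => Ad u N) '' (cellUnipotents π ∩ leviGroup (diagonal s)))
        ∩ complementRoots π H).ncard +
      (cellRoots π ∩ nilradicalRoots (diagonal s) ∩ complementRoots π H).ncard := by
  rw [← Set.ncard_union_eq _ (Set.toFinite _) (Set.toFinite _)]
  · congr 1
    ext p
    have key : ∀ hp : p ∈ complementRoots π H, (∃ k < p.2, shift (diagonal s + N) p.2 p.1 k ≠ 0) ↔
        s p.1 = s p.2 ∧ (∃ k < p.2, N p.1 k ≠ 0) ∨ s p.1 ≠ s p.2 := by
      intro hp
      by_cases hs : s p.1 = s p.2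
      · simp only [hs, true_and, ne_eq, not_true_eq_false, or_false]
        refine exists_congr fun k => and_congr_right fun hk => not_congr ?_
        rcases eq_or_ne p.1 k with rfl | hik
        · rw [h.shift_self, hs, sub_self]
          refine ⟨fun _ => ?_, fun _ => rfl⟩
          by_contra h0
          exact (h.lt h0).ne rfl
        · rw [shift_of_ne _ _ _ hik]
      · simp only [hs, false_and, ne_eq, not_false_eq_true, or_true, iff_true]
        exact ⟨p.1, hp.1, by rwa [h.shift_self, sub_eq_zero]⟩
    constructor
    · rintro ⟨hp, hk⟩
      rcases (key hp).1 hk with h1 | h1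
      · exact Or.inl ⟨(h.mem_rootsOfSet hH hC hp).2 h1, hp⟩
      · exact Or.inr ⟨⟨complementRoots_subset_cellRoots hH π hp,
          h.mem_nilradicalRoots.2 ⟨hp.1, h1⟩⟩, hp⟩
    · rintro (⟨h1, hp⟩ | ⟨⟨-, h1⟩, hp⟩)
      · exact ⟨hp, (key hp).2 (Or.inl ((h.mem_rootsOfSet hH hC hp).1 h1))⟩
      · exact ⟨hp, (key hp).2 (Or.inr (h.mem_nilradicalRoots.1 h1).2)⟩
  · rw [Set.disjoint_left]
    rintro p ⟨h1, hp⟩ ⟨⟨-, h2⟩, -⟩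
    exact (h.mem_nilradicalRoots.1 h2).2 ((h.mem_rootsOfSet hH hC hp).1 h1).1

end IsNormalForm

/-! ## Coordinates on the opposite big cell -/

section coordinates

variable {n : ℕ}

/-- The minor of `g` in the columns up to `q` and the rows before `q`, together with row `p`. -/
noncomputable def flagMinor (q p : Fin n) (g : Matrix (Fin n) (Fin n) ℂ) : ℂ :=
  (Matrix.of fun r c : {r : Fin n // r ≤ q} => g (if r.1 = q then p else r.1) c.1).det

/-- The columns of gb up to q are combinations of those of g up to q, so the submatrix factors. The
second factor does not depend on p, and ratios with the same q descend to the flag variety. -/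
theorem flagMinor_mul (q p : Fin n) (g : Matrix (Fin n) (Fin n) ℂ)
    {b : Matrix (Fin n) (Fin n) ℂ} (hb : b ∈ borelAlgebra n) :
    flagMinor q p (g * b) = flagMinor q p g * flagMinor q q b := by
  rw [flagMinor, flagMinor, flagMinor, ← Matrix.det_mul]
  congr 1
  ext r c
  simp only [Matrix.of_apply, Matrix.mul_apply]
  have h0 : ∀ k, ¬ k ≤ q → g (if r.1 = q then p else r.1) k * b k c.1 = 0 := by
    intro k hk
    rw [hb _ _ (c.2.trans_lt (not_le.1 hk)), mul_zero]
  rw [← Finset.sum_subset (Finset.subset_univ (Finset.univ.filter fun k => k ≤ q))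
    fun k _ hk => h0 k (by simpa using hk), Finset.sum_subtype (p := fun k => k ≤ q) _ (by simp)]
  refine Finset.sum_congr rfl fun k _ => ?_
  congr 2
  split_ifs with h
  · exact h
  · rfl

theorem apply_self_ne_zero_of_mem_borelSubgroup {b : GL (Fin n) ℂ} (hb : b ∈ borelSubgroup n)
    (i : Fin n) : b.val i i ≠ 0 := by
  have h := mul_apply_self_of_upper hb ((borelSubgroup n).inv_mem hb) i
  rw [Units.mul_inv, Matrix.one_apply_eq] at h
  exact left_ne_zero_of_mul (h ▸ one_ne_zero)

theorem flagMinor_ne_zero {b : GL (Fin n) ℂ} (hb : b ∈ borelSubgroup n) (q : Fin n) :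
    flagMinor q q b.val ≠ 0 := by
  rw [flagMinor, Matrix.det_of_isUpperTriangular]
  · refine Finset.prod_ne_zero_iff.2 fun r _ => ?_
    rw [Matrix.of_apply]
    split_ifs with h
    · rw [h]
      exact apply_self_ne_zero_of_mem_borelSubgroup hb q
    · exact apply_self_ne_zero_of_mem_borelSubgroup hb r
  · intro r c hrc
    rw [Matrix.of_apply]
    split_ifs with h
    · exact hb _ _ (lt_of_lt_of_eq (Subtype.coe_lt_coe.2 hrc) h)
    · exact hb _ _ hrc

/-- The submatrix is lower triangular with diagonal entries 1, except for the last one, which is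
l_pq. -/
theorem flagMinor_of_mem_oppositeUnipotents {l : GL (Fin n) ℂ} (hl : l ∈ oppositeUnipotents n)
    (q p : Fin n) : flagMinor q p l.val = l.val p q := by
  rw [flagMinor, Matrix.det_of_isLowerTriangular]
  · rw [Finset.prod_eq_single ⟨q, le_rfl⟩]
    · simp
    · intro r _ hr
      have : r.1 ≠ q := fun h => hr (Subtype.ext h)
      rw [Matrix.of_apply, if_neg this]
      exact hl.1 _
    · simp
  · intro r c hrc
    have hrc' : r < c := hrc
    have : r.1 ≠ q := (lt_of_lt_of_le (Subtype.coe_lt_coe.2 hrc') c.2).ne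
    rw [Matrix.of_apply, if_neg this]
    exact hl.2 _ _ hrc'

/-- The coordinate `(p, q)` of the flag `cl`, where `l ∈ U⁻`. -/
noncomputable def flagCoordinate (c : GL (Fin n) ℂ) (p q : Fin n) (z : FlagSpace n) : ℂ :=
  flagMinor q p (c⁻¹ * z.out).val / flagMinor q q (c⁻¹ * z.out).val

theorem flagCoordinate_mk (c : GL (Fin n) ℂ) (p q : Fin n) (g : GL (Fin n) ℂ) :
    flagCoordinate c p q (QuotientGroup.mk g) =
      flagMinor q p (c⁻¹ * g).val / flagMinor q q (c⁻¹ * g).val := by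
  obtain ⟨b, hb⟩ := QuotientGroup.mk_out_eq_mul (borelSubgroup n) g
  rw [flagCoordinate, hb, ← mul_assoc, Units.val_mul _ b.1, flagMinor_mul _ _ _ b.2,
    flagMinor_mul _ _ _ b.2, mul_div_mul_right _ _ (flagMinor_ne_zero b.2 q)]

theorem generalLinear_regularAt_flagMinor (c : GL (Fin n) ℂ) (q p : Fin n) (g : GL (Fin n) ℂ) :
    (generalLinear n).RegularAt g fun g => flagMinor q p (c⁻¹ * g).val := by
  refine (isGeometric_generalLinear n).det fun r k => ?_
  exact (isGeometric_generalLinear n).matrix_mul (A := fun _ => (c⁻¹).val) (A' := fun g => g.val)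
    (fun i j => (isGeometric_generalLinear n).const _ _)
    (fun i j => generalLinear_regularAt_apply g i j) _ _

theorem flagVariety_regularAt_flagCoordinate (c : GL (Fin n) ℂ) (p q : Fin n)
    {g : GL (Fin n) ℂ} (hg : flagMinor q q (c⁻¹ * g).val ≠ 0) :
    (flagVariety n).RegularAt (QuotientGroup.mk g) (flagCoordinate c p q) := by
  refine flagVariety_regularAt (generalLinear_regularAt_flagMinor c q p)
    (generalLinear_regularAt_flagMinor c q q) (flagCoordinate_mk c p q) ?_ hg
  intro g b hb h
  rw [← mul_assoc, Units.val_mul _ b, flagMinor_mul _ _ _ hb]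
  exact mul_ne_zero h (flagMinor_ne_zero hb q)

/-- Translation by aπ brings the cell into the opposite big cell, where the denominators of
`flagCoordinate` equal 1. -/
theorem mem_oppositeUnipotents_of_cellGL (a : GL (Fin n) ℂ) (π : Equiv.Perm (Fin n))
    (x : cellRoots π → ℂ) :
    (a * permGL π)⁻¹ * (a * cellGL π x * permGL π) ∈ oppositeUnipotents n := by
  have : (a * permGL π)⁻¹ * (a * cellGL π x * permGL π) =
      (permGL π)⁻¹ * cellGL π x * permGL π := by group
  rw [this]
  exact (cellGL_mem_cellUnipotents x).2

theorem flagCoordinate_cellGL (a : GL (Fin n) ℂ) (π : Equiv.Perm (Fin n))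
    (x : cellRoots π → ℂ) (w : cellRoots π) :
    flagCoordinate (a * permGL π) (π⁻¹ w.1.1) (π⁻¹ w.1.2)
      (QuotientGroup.mk (a * cellGL π x * permGL π)) = x w := by
  have h := mem_oppositeUnipotents_of_cellGL a π x
  rw [flagCoordinate_mk, flagMinor_of_mem_oppositeUnipotents h,
    flagMinor_of_mem_oppositeUnipotents h, h.1, div_one]
  have : (a * permGL π)⁻¹ * (a * cellGL π x * permGL π) =
      (permGL π)⁻¹ * cellGL π x * permGL π := by group
  rw [this, permGL_conj_apply, Equiv.Perm.coe_inv, Equiv.apply_symm_apply, Equiv.apply_symm_apply,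
    coe_cellGL, cellMatrix_mem]

theorem flagVariety_regularAt_cellGL (a : GL (Fin n) ℂ) (π : Equiv.Perm (Fin n))
    (x : cellRoots π → ℂ) (p q : Fin n) :
    (flagVariety n).RegularAt (QuotientGroup.mk (a * cellGL π x * permGL π))
      (flagCoordinate (a * permGL π) p q) := by
  refine flagVariety_regularAt_flagCoordinate _ _ _ ?_
  have h := mem_oppositeUnipotents_of_cellGL a π x
  rw [flagMinor_of_mem_oppositeUnipotents h, h.1]
  exact one_ne_zero

end coordinates

/-! ## The Bruhat decomposition -/

section Bruhat

variable {n : ℕ}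

theorem mul_permGL_inv_apply (g : GL (Fin n) ℂ) (π : Equiv.Perm (Fin n)) (i j : Fin n) :
    (g * (permGL π)⁻¹ : GL (Fin n) ℂ).val i j = g.val i (π⁻¹ j) := by
  have h : ((permGL π)⁻¹ : GL (Fin n) ℂ).val = Matrix.of fun i j => if π i = j then 1 else 0 := rfl
  rw [Units.val_mul, h, Matrix.mul_apply, Finset.sum_eq_single (π⁻¹ j)]
  · simp
  · intro k _ hk
    rw [Matrix.of_apply, if_neg, mul_zero]
    rintro rfl
    simp at hk
  · simp

theorem mul_permGL_apply (g : GL (Fin n) ℂ) (π : Equiv.Perm (Fin n)) (i q : Fin n) :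
    (g * permGL π : GL (Fin n) ℂ).val i q = g.val i (π q) := by
  have := mul_permGL_inv_apply (g * permGL π) π i (π q)
  rw [mul_inv_cancel_right] at this
  rw [this]
  simp

/-- Column elimination: the columns before `m` can be brought to reduced form. -/
theorem exists_reduced_columns (g : GL (Fin n) ℂ) (m : ℕ) :
    ∃ b ∈ borelSubgroup n, ∃ p : Fin n → Fin n, ∀ q : Fin n, (q : ℕ) < m →
      (g * b).val (p q) q = 1 ∧ (∀ i, p q < i → (g * b).val i q = 0) ∧
      ∀ q' < q, (g * b).val (p q') q = 0 := by
  induction m with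
  | zero => exact ⟨1, (borelSubgroup n).one_mem, id, fun q hq => absurd hq (Nat.not_lt_zero _)⟩
  | succ m ih =>
    obtain ⟨b, hb, p, hp⟩ := ih
    by_cases hm : n ≤ m
    · exact ⟨b, hb, p, fun q _ => hp q (q.2.trans_le hm)⟩
    rw [not_le] at hm
    let m' : Fin n := ⟨m, hm⟩
    set h := (g * b).val with hh
    have step : ∀ t ≤ m, ∃ c : Fin n → ℂ, c m' = 1 ∧ (∀ k, m' < k → c k = 0) ∧
        ∀ q : Fin n, (q : ℕ) < t → (h *ᵥ c) (p q) = 0 := by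
      intro t
      induction t with
      | zero =>
        refine fun _ => ⟨Pi.single m' 1, Pi.single_eq_same _ _, fun k hk => ?_,
          fun q hq => absurd hq (Nat.not_lt_zero _)⟩
        exact Pi.single_eq_of_ne hk.ne' _
      | succ t iht =>
        intro ht
        obtain ⟨c, hc1, hc2, hc3⟩ := iht (by omega)
        let t' : Fin n := ⟨t, by omega⟩
        have ht' : t' < m' := Fin.lt_def.2 (by simp only [t', m']; omega)
        -- This clears the pivot row of column t'. The rows cleared before stay zero, because column
        -- t' vanishes in the pivot rows of earlier columns.
        refine ⟨c - Pi.single t' ((h *ᵥ c) (p t')), ?_, ?_, ?_⟩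
        · rw [Pi.sub_apply, hc1, Pi.single_eq_of_ne ht'.ne', sub_zero]
        · intro k hk
          rw [Pi.sub_apply, hc2 k hk, Pi.single_eq_of_ne (ht'.trans hk).ne', sub_zero]
        · intro q hq
          rw [Matrix.mulVec_sub, Pi.sub_apply, Matrix.mulVec_single, Pi.smul_apply,
            MulOpposite.smul_eq_mul_unop, MulOpposite.unop_op, Matrix.col_apply]
          rcases Nat.lt_succ_iff_lt_or_eq.1 hq with hq' | hq'
          · rw [hc3 q hq', (hp t' (by simp only [t']; omega)).2.2 q hq', zero_mul, sub_zero]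
          · have : q = t' := Fin.ext hq'
            rw [this, (hp t' (by simp only [t']; omega)).1, one_mul, sub_self]
    obtain ⟨c, hc1, hc2, hc3⟩ := step m le_rfl
    have hv : h *ᵥ c ≠ 0 := by
      intro h0
      have h1 : (g * b)⁻¹.val *ᵥ (h *ᵥ c) = c := by
        rw [Matrix.mulVec_mulVec, hh, Units.inv_mul, Matrix.one_mulVec]
      rw [h0, Matrix.mulVec_zero] at h1
      rw [← h1] at hc1
      exact zero_ne_one hc1
    obtain ⟨i1, hi1⟩ := Function.ne_iff.1 hv
    -- The lowest nonzero row of the new column becomes its pivot row.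
    obtain ⟨i0, hi0, hmax⟩ := Set.exists_max_image {i | (h *ᵥ c) i ≠ 0} id (Set.toFinite _)
      ⟨i1, hi1⟩
    let d := ((h *ᵥ c) i0)⁻¹ • c
    have hd : (d m') ≠ 0 := by
      simp only [d, Pi.smul_apply, hc1, smul_eq_mul, mul_one]
      exact inv_ne_zero hi0
    have hupper : (Matrix.updateCol 1 m' d : Matrix (Fin n) (Fin n) ℂ).BlockTriangular id := by
      intro i j hij
      rcases eq_or_ne j m' with rfl | hj
      · rw [Matrix.updateCol_self]
        simp only [d, Pi.smul_apply, hc2 i hij, smul_zero]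
      · rw [Matrix.updateCol_ne hj, Matrix.one_apply_ne (show i ≠ j from ne_of_gt hij)]
    have hdet : (Matrix.updateCol 1 m' d : Matrix (Fin n) (Fin n) ℂ).det ≠ 0 := by
      rw [Matrix.det_of_isUpperTriangular hupper]
      refine Finset.prod_ne_zero_iff.2 fun i _ => ?_
      rcases eq_or_ne i m' with rfl | hi
      · rwa [Matrix.updateCol_self]
      · rw [Matrix.updateCol_ne hi, Matrix.one_apply_eq]
        exact one_ne_zero
    let b1 : GL (Fin n) ℂ := Matrix.GeneralLinearGroup.mkOfDetNeZero _ hdet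
    have hb1 : b1.val = Matrix.updateCol 1 m' d := rfl
    have hb1B : b1 ∈ borelSubgroup n := fun i j hij => hupper hij
    have hcol : ∀ i, (g * (b * b1)).val i m' = ((h *ᵥ c) i0)⁻¹ * (h *ᵥ c) i := by
      intro i
      have : (h *ᵥ d) i = ((h *ᵥ c) i0)⁻¹ * (h *ᵥ c) i := by
        simp only [d, Matrix.mulVec_smul, Pi.smul_apply, smul_eq_mul]
      rw [← this, ← mul_assoc, Units.val_mul, hb1, ← hh, Matrix.mul_apply]
      simp only [Matrix.updateCol_self]
      rfl
    have hcol' : ∀ i j, j ≠ m' → (g * (b * b1)).val i j = h i j := by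
      intro i j hj
      rw [← mul_assoc, Units.val_mul, hb1, ← hh, Matrix.mul_apply]
      simp only [Matrix.updateCol_ne hj]
      rw [← Matrix.mul_apply, mul_one]
    refine ⟨b * b1, (borelSubgroup n).mul_mem hb hb1B, Function.update p m' i0, fun q hq => ?_⟩
    rcases Nat.lt_succ_iff_lt_or_eq.1 hq with hq' | hq'
    · have hne : ∀ q' ≤ q, q' ≠ m' := fun q' hq'' => (lt_of_le_of_lt hq'' hq').ne
      rw [Function.update_of_ne (hne q le_rfl)]
      simp only [hcol' _ _ (hne q le_rfl)]
      refine ⟨(hp q hq').1, (hp q hq').2.1, fun q' h1 => ?_⟩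
      rw [Function.update_of_ne (hne q' h1.le)]
      exact (hp q hq').2.2 q' h1
    · have hq : q = m' := Fin.ext hq'
      subst hq
      rw [Function.update_self]
      simp only [hcol]
      refine ⟨inv_mul_cancel₀ hi0, fun i hi => ?_, fun q' h1 => ?_⟩
      · by_cases h0 : (h *ᵥ c) i = 0
        · rw [h0, mul_zero]
        · exact absurd (hmax i h0) (not_le.2 hi)
      · rw [Function.update_of_ne h1.ne, hc3 q' h1, mul_zero]

/-- In the reduced form each column is 1 at its own pivot and 0 at earlier ones, so the pivot rows
form a permutation. Undoing it by π⁻¹ on the right leaves an element of U_π. -/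
theorem exists_bruhat (g : GL (Fin n) ℂ) :
    ∃ (π : Equiv.Perm (Fin n)) (x : cellRoots π → ℂ), ∃ b ∈ borelSubgroup n,
      g = cellGL π x * permGL π * b := by
  obtain ⟨b, hb, p, hp⟩ := exists_reduced_columns g n
  have hne : ∀ q' q, q' < q → p q' ≠ p q := by
    intro q' q hlt he
    have h1 := (hp q q.2).2.2 q' hlt
    rw [he, (hp q q.2).1] at h1
    exact one_ne_zero h1
  have hinj : Function.Injective p := by
    intro q q' h
    by_contra hqq
    rcases lt_or_gt_of_ne hqq with h1 | h1
    · exact hne _ _ h1 h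
    · exact hne _ _ h1 h.symm
  let π : Equiv.Perm (Fin n) := Equiv.ofBijective p (Finite.injective_iff_bijective.1 hinj)
  have hπ : ∀ q, π q = p q := fun _ => rfl
  have hu : g * b * (permGL π)⁻¹ ∈ cellUnipotents π := by
    refine ⟨⟨fun i => ?_, fun i j hij => ?_⟩, fun i => ?_, fun i j hij => ?_⟩
    · rw [mul_permGL_inv_apply]
      have := (hp (π⁻¹ i) (Fin.is_lt _)).1
      rwa [← hπ, Equiv.Perm.coe_inv, Equiv.apply_symm_apply] at this
    · rw [mul_permGL_inv_apply]
      refine (hp (π⁻¹ j) (Fin.is_lt _)).2.1 i ?_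
      rwa [← hπ, Equiv.Perm.coe_inv, Equiv.apply_symm_apply]
    · rw [permGL_conj_apply, mul_permGL_inv_apply, Equiv.Perm.coe_inv, Equiv.symm_apply_apply]
      exact (hp i i.2).1
    · rw [permGL_conj_apply, mul_permGL_inv_apply, Equiv.Perm.coe_inv, Equiv.symm_apply_apply]
      exact (hp j j.2).2.2 i hij
  refine ⟨π, fun w => (g * b * (permGL π)⁻¹).val w.1.1 w.1.2, b⁻¹,
    (borelSubgroup n).inv_mem hb, ?_⟩
  rw [← eq_cellGL_of_mem hu]
  group

theorem bruhat_disjoint {π π' : Equiv.Perm (Fin n)} {b c b' c' : GL (Fin n) ℂ}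
    (hb : b ∈ borelSubgroup n) (hc : c ∈ borelSubgroup n) (hb' : b' ∈ borelSubgroup n)
    (hc' : c' ∈ borelSubgroup n) (h : b * permGL π * c = b' * permGL π' * c') : π = π' := by
  have h1 : permGL π = (b⁻¹ * b') * permGL π' * (c' * c⁻¹) := by
    have : permGL π = b⁻¹ * (b * permGL π * c) * c⁻¹ := by group
    rw [this, h]
    group
  have hB := (borelSubgroup n).mul_mem ((borelSubgroup n).inv_mem hb) hb'
  have hC := (borelSubgroup n).mul_mem hc' ((borelSubgroup n).inv_mem hc)
  -- Comparing the entries (π q, q), where the left side is a nonzero diagonal entry of an element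
  -- of `B`. A permutation with σ q ≤ q for all q is the identity.
  have hle : ∀ q, π'⁻¹ (π q) ≤ q := by
    intro q
    have h2 : (b⁻¹ * b')⁻¹ * permGL π = permGL π' * (c' * c⁻¹) := by
      rw [h1]
      group
    have h3 := congrArg (fun g : GL (Fin n) ℂ => g.val (π q) q) h2
    simp only [mul_permGL_apply] at h3
    have h4 : (permGL π' * (c' * c⁻¹)).val (π q) q = (c' * c⁻¹).val (π'⁻¹ (π q)) q := by
      have h5 : (permGL π').val = Matrix.of fun i j => if i = π' j then 1 else 0 := rfl
      rw [Units.val_mul, h5, Matrix.mul_apply, Finset.sum_eq_single (π'⁻¹ (π q))]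
      · simp
      · intro k _ hk
        rw [Matrix.of_apply, if_neg, zero_mul]
        intro h6
        rw [h6] at hk
        simp at hk
      · simp
    rw [h4] at h3
    by_contra hlt
    rw [hC _ _ (not_le.1 hlt)] at h3
    exact apply_self_ne_zero_of_mem_borelSubgroup ((borelSubgroup n).inv_mem hB) _ h3
  have hσ : ∀ q : Fin n, π'⁻¹ (π q) = q := by
    intro q
    induction q using WellFoundedLT.induction with
    | ind q ih =>
      refine (hle q).eq_of_not_lt fun hlt => ?_
      have h2 := ih _ hlt
      have h3 : π'⁻¹ (π q) = q := π.injective (π'⁻¹.injective h2)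
      exact hlt.ne h3
  refine Equiv.ext fun q => ?_
  have := congrArg π' (hσ q)
  rwa [Equiv.Perm.coe_inv, Equiv.apply_symm_apply] at this

theorem mem_schubertCell {a : GL (Fin n) ℂ} {π : Equiv.Perm (Fin n)} {z : FlagSpace n} :
    z ∈ schubertCell a π ↔
      ∃ x : cellRoots π → ℂ, z = QuotientGroup.mk (a * cellGL π x * permGL π) := by
  constructor
  · rintro ⟨b, hb, rfl⟩
    obtain ⟨π', x, c, hc, h⟩ := exists_bruhat (b * permGL π)
    have hπ : π = π' := bruhat_disjoint hb (borelSubgroup n).one_mem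
      (cellGL_mem_borelSubgroup x) hc (by rw [mul_one, h])
    subst hπ
    refine ⟨x, QuotientGroup.eq.2 ?_⟩
    have : (a * b * permGL π)⁻¹ * (a * cellGL π x * permGL π) = c⁻¹ := by
      rw [mul_assoc a b, h]
      group
    rw [this]
    exact (borelSubgroup n).inv_mem hc
  · rintro ⟨x, rfl⟩
    exact ⟨_, cellGL_mem_borelSubgroup x, rfl⟩

theorem disjoint_schubertCell {a : GL (Fin n) ℂ} {π π' : Equiv.Perm (Fin n)} (h : π ≠ π') :
    Disjoint (schubertCell a π) (schubertCell a π') := by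
  rw [Set.disjoint_left]
  rintro z ⟨b, hb, rfl⟩ ⟨b', hb', he⟩
  have hc := QuotientGroup.eq.1 he
  refine h (bruhat_disjoint hb hc hb' (borelSubgroup n).one_mem ?_)
  group

theorem iUnion_schubertCell (a : GL (Fin n) ℂ) :
    ⋃ π, schubertCell a π = (Set.univ : Set (FlagSpace n)) := by
  refine Set.eq_univ_of_forall fun z => ?_
  obtain ⟨g, rfl⟩ := QuotientGroup.mk_surjective z
  obtain ⟨π, x, b, hb, h⟩ := exists_bruhat (a⁻¹ * g)
  refine Set.mem_iUnion.2 ⟨π, cellGL π x, cellGL_mem_borelSubgroup x, QuotientGroup.eq.2 ?_⟩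
  have : g⁻¹ * (a * cellGL π x * permGL π) = b⁻¹ := by
    rw [show g = a * (a⁻¹ * g) by group, h]
    group
  rw [this]
  exact (borelSubgroup n).inv_mem hb

end Bruhat

/-! ## The cells of Hessenberg varieties are affine spaces -/

section cells

variable {n : ℕ}

theorem generalLinear_isMorphism_cellGL {σ : Type*} (a c : GL (Fin n) ℂ) (π : Equiv.Perm (Fin n))
    (Q : cellRoots π → MvPolynomial σ ℂ) :
    IsMorphism (affineSpace σ) (generalLinear n)
      fun y => a * cellGL π (fun w => MvPolynomial.eval y (Q w)) * c := by
  refine isMorphism_induced (isGeometric_affineSpace σ)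
    (isMorphism_affineSpace (isGeometric_affineSpace σ) fun x p => ?_)
  have hG := isGeometric_affineSpace σ
  refine hG.matrix_mul (A := fun y => a.val * cellMatrix π (fun w => MvPolynomial.eval y (Q w)))
    (A' := fun _ => c.val) (fun i j => ?_) (fun i j => hG.const _ _) _ _
  refine hG.matrix_mul (A := fun _ => a.val) (fun i j => hG.const _ _) (fun i j => ?_) _ _
  by_cases hij : i = j
  · subst hij
    simp only [cellMatrix_self]
    exact hG.const _ _
  by_cases hp : (i, j) ∈ cellRoots π
  · have : ∀ y : σ → ℂ, cellMatrix π (fun w => MvPolynomial.eval y (Q w)) i j =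
        MvPolynomial.eval y (Q ⟨(i, j), hp⟩) := fun y => cellMatrix_mem _ ⟨(i, j), hp⟩
    simp only [this]
    exact affineSpace_regularAt_eval _ _
  · simp only [cellMatrix_of_notMem _ hij hp]
    exact hG.const _ _

/-- The intersection of a Schubert cell with a Hessenberg variety is an affine space. -/
theorem isomorphic_cell {H : Submodule ℂ (Matrix (Fin n) (Fin n) ℂ)} (hH : IsHessenbergSpace H)
    {π : Equiv.Perm (Fin n)} {a : GL (Fin n) ℂ} {M : Matrix (Fin n) (Fin n) ℂ}
    (hX : IsEchelon (Ad a⁻¹ M)) (hC : ∀ p ∈ complementRoots π H, Ad a⁻¹ M p.1 p.2 = 0) {d : ℕ}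
    (hd : (cellRoots π).ncard = d + (pivotRoots (Ad a⁻¹ M) (complementRoots π H)).ncard) :
    Isomorphic ((flagVariety n).sub (schubertCell a π ∩ hessenbergVariety M H))
      (affineSpace (Fin d)) := by
  classical
  obtain ⟨D, Q, hD, hQ1, hQ2, hQ3⟩ := exists_parametrization hH hX hC
  have hcard : Nat.card {w : cellRoots π // w ∉ D} = d := by
    have h1 := Set.ncard_add_ncard_compl D
    rw [hD, Nat.card_coe_set_eq, hd] at h1
    have h2 : Nat.card {w : cellRoots π // w ∉ D} = Dᶜ.ncard := Nat.card_coe_set_eq Dᶜ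
    omega
  let e : {w : cellRoots π // w ∉ D} ≃ Fin d := Finite.equivFinOfCardEq hcard
  let x : (Fin d → ℂ) → cellRoots π → ℂ := fun y w => MvPolynomial.eval (y ∘ e) (Q w)
  let S := schubertCell a π ∩ hessenbergVariety M H
  -- `F` reads the free coordinates off the flag as ratios of minors, and `E` inserts them into the
  -- polynomial solution of the equations.
  let F : S → Fin d → ℂ := fun z i =>
    flagCoordinate (a * permGL π) (π⁻¹ (e.symm i).1.1.1) (π⁻¹ (e.symm i).1.1.2) z.1
  let E : (Fin d → ℂ) → S := fun y => ⟨QuotientGroup.mk (a * cellGL π (x y) * permGL π),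
    mem_schubertCell.2 ⟨_, rfl⟩,
    (mk_cellGL_mem_hessenbergVariety hH hX.upper _).2 (hQ2 _)⟩
  have hFE : ∀ y, F (E y) = y := by
    intro y
    funext i
    simp only [F, E, flagCoordinate_cellGL, x, hQ1, Function.comp_apply, Equiv.apply_symm_apply]
  have hEF : ∀ z, E (F z) = z := by
    rintro ⟨z, hz, hzH⟩
    obtain ⟨x₀, rfl⟩ := mem_schubertCell.1 hz
    have h1 := hQ3 x₀ ((mk_cellGL_mem_hessenbergVariety hH hX.upper _).1 hzH)
    have h2 : x (F ⟨_, hz, hzH⟩) = x₀ := by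
      funext w
      rw [← h1 w]
      simp only [x, F]
      congr 2
      funext v
      simp only [Function.comp_apply, Equiv.symm_apply_apply, flagCoordinate_cellGL]
    refine Subtype.ext ?_
    simp only [E, h2]
  have hS : ((flagVariety n).sub S).IsGeometric := (isGeometric_flagVariety n).induced _
  refine ⟨⟨F, E, hEF, hFE⟩, isMorphism_affineSpace hS ?_, ?_⟩
  · rintro ⟨z, hz, hzH⟩ i
    obtain ⟨x₀, rfl⟩ := mem_schubertCell.1 hz
    exact regularAt_induced (𝒴 := flagVariety n) (Subtype.val : S → FlagSpace n)
      (x := ⟨_, hz, hzH⟩) (F := flagCoordinate _ _ _) (flagVariety_regularAt_cellGL a π x₀ _ _)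
  · refine isMorphism_induced (isGeometric_affineSpace _) ?_
    have h1 := generalLinear_isMorphism_cellGL a (permGL π) π
      fun w => MvPolynomial.rename e (Q w)
    have h2 := (isMorphism_quotient (QuotientGroup.mk : _ → FlagSpace n) (generalLinear n)).comp h1
    simp only [MvPolynomial.eval_rename] at h2
    exact h2

end cells

/-! ## Closures of Schubert cells -/

section closure

variable {n : ℕ}

/-- Let C vanish on a complement of ker A and map ker A isomorphically onto a complement of the
range. Then A + C is injective, and the rank of C is at most that of this complement. -/
theorem exists_rank_completion (A : Matrix (Fin n) (Fin n) ℂ) :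
    ∃ C : Matrix (Fin n) (Fin n) ℂ, C.rank + A.rank ≤ n ∧ (A + C).det ≠ 0 := by
  let f := Matrix.toLin' A
  obtain ⟨K, hK⟩ := Submodule.exists_isCompl (LinearMap.ker f)
  obtain ⟨R, hR⟩ := Submodule.exists_isCompl (LinearMap.range f)
  have h1 := LinearMap.finrank_range_add_finrank_ker f
  have h2 := Submodule.finrank_add_eq_of_isCompl hR
  have h3 : Module.finrank ℂ (LinearMap.ker f) = Module.finrank ℂ R := by omega
  let φ := LinearEquiv.ofFinrankEq _ _ h3
  let p := Submodule.projectionOnto _ _ hK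
  let c : (Fin n → ℂ) →ₗ[ℂ] (Fin n → ℂ) := R.subtype ∘ₗ φ.toLinearMap ∘ₗ p
  have hA : A.rank = Module.finrank ℂ (LinearMap.range f) := by
    rw [Matrix.rank_eq_finrank_range_toLin A (Pi.basisFun ℂ _) (Pi.basisFun ℂ _)]
    rfl
  refine ⟨LinearMap.toMatrix' c, ?_, ?_⟩
  · have h4 : (LinearMap.toMatrix' c).rank ≤ Module.finrank ℂ R := by
      rw [Matrix.rank, ← Matrix.toLin'_apply', Matrix.toLin'_toMatrix']
      refine Submodule.finrank_mono ?_
      rintro _ ⟨v, rfl⟩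
      exact (φ (p v)).2
    rw [Module.finrank_fin_fun] at h2
    omega
  · rw [← LinearMap.det_toLin', map_add, Matrix.toLin'_toMatrix', ← isUnit_iff_ne_zero,
      ← LinearMap.isUnit_iff_isUnit_det, LinearMap.isUnit_iff_ker_eq_bot, LinearMap.ker_eq_bot']
    intro v hv
    have h5 : f v = - c v := eq_neg_of_add_eq_zero_left hv
    have h6 : f v = 0 := by
      have : f v ∈ LinearMap.range f ⊓ R :=
        ⟨⟨v, rfl⟩, by rw [h5]; exact R.neg_mem (φ (p v)).2⟩
      rwa [hR.inf_eq_bot, Submodule.mem_bot] at this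
    have h7 : φ (p v) = 0 := by
      rw [h6, eq_comm, neg_eq_zero] at h5
      exact Subtype.ext h5
    have h8 : p v = ⟨v, h6⟩ := Submodule.projectionOnto_apply_left hK ⟨v, h6⟩
    rw [LinearEquiv.map_eq_zero_iff, h8] at h7
    exact congrArg Subtype.val h7

theorem rank_add_le_rank_add_rank (A C : Matrix (Fin n) (Fin n) ℂ) :
    (A + C).rank ≤ A.rank + C.rank := by
  rw [Matrix.rank, Matrix.rank, Matrix.rank]
  refine (Submodule.finrank_mono ?_).trans (Submodule.finrank_add_le_finrank_add_finrank _ _)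
  rintro _ ⟨v, rfl⟩
  rw [Matrix.mulVecLin_add, LinearMap.add_apply]
  exact Submodule.add_mem_sup ⟨v, rfl⟩ ⟨v, rfl⟩

/-- Wherever det(A(y) + C) ≠ 0, the rank of A(y) is at least n - rank C, hence at least that of
A(x). This is an open condition at x. -/
theorem isClosed_rank_le {X : Type*} {𝒳 : FunctionSpace X} (h𝒳 : 𝒳.IsGeometric)
    {A : X → Matrix (Fin n) (Fin n) ℂ} (hA : ∀ x i j, 𝒳.RegularAt x fun y => A y i j) (r : ℕ) :
    IsClosed[𝒳.top] {x | (A x).rank ≤ r} := by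
  let _ := 𝒳.top
  refine ⟨isOpen_iff_mem_nhds.2 fun x hx => ?_⟩
  obtain ⟨C, hC, hdet⟩ := exists_rank_completion (A x)
  have hreg : 𝒳.RegularAt x fun y => (A y + C).det :=
    h𝒳.det fun i j => h𝒳.add (hA x i j) (h𝒳.const x _)
  filter_upwards [h𝒳.ne_zero hreg hdet] with y hy
  have h1 : (A y + C).rank = n := by
    rw [Matrix.rank_of_isUnit _ ((Matrix.isUnit_iff_isUnit_det _).2 hy.isUnit), Fintype.card_fin]
  have h2 := rank_add_le_rank_add_rank (A y) C
  have h3 : ¬ (A x).rank ≤ r := hx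
  simp only [Set.mem_compl_iff, Set.mem_ofPred_eq]
  omega

/-- The rank of the lower left corner of `g` with rows from `i` on and columns up to `j`. -/
noncomputable def cornerRank (g : Matrix (Fin n) (Fin n) ℂ) (i j : Fin n) : ℕ :=
  (diagonal (fun k => if i ≤ k then (1 : ℂ) else 0) * g *
    diagonal (fun k => if k ≤ j then (1 : ℂ) else 0)).rank

/-- Multiplication by `b` adds lower rows to higher ones, and by `c` earlier columns to later ones.
The corner of the product is therefore obtained from the corner of g by multiplication on both
sides. -/
theorem cornerRank_mul_le (g : Matrix (Fin n) (Fin n) ℂ) {b c : Matrix (Fin n) (Fin n) ℂ}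
    (hb : b ∈ borelAlgebra n) (hc : c ∈ borelAlgebra n) (i j : Fin n) :
    cornerRank (b * g * c) i j ≤ cornerRank g i j := by
  let P : Matrix (Fin n) (Fin n) ℂ := diagonal fun k => if i ≤ k then (1 : ℂ) else 0
  let Q : Matrix (Fin n) (Fin n) ℂ := diagonal fun k => if k ≤ j then (1 : ℂ) else 0
  have hP : P * b = P * b * P := by
    ext k l
    simp only [P, Matrix.mul_diagonal, Matrix.diagonal_mul]
    by_cases h1 : i ≤ k
    · by_cases h2 : i ≤ l
      · simp [h2]
      · rw [hb _ _ ((not_le.1 h2).trans_le h1)]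
        simp
    · simp [h1]
  have hQ : c * Q = Q * c * Q := by
    ext k l
    simp only [Q, Matrix.mul_diagonal, Matrix.diagonal_mul]
    by_cases h1 : l ≤ j
    · by_cases h2 : k ≤ j
      · simp [h2]
      · rw [hc _ _ (h1.trans_lt (not_le.1 h2))]
        simp
    · simp [h1]
  have h : P * (b * g * c) * Q = P * b * (P * g * Q) * (c * Q) := by
    calc P * (b * g * c) * Q = P * b * g * (c * Q) := by simp only [mul_assoc]
      _ = P * b * P * g * (Q * c * Q) := by rw [← hP, ← hQ]
      _ = _ := by simp only [mul_assoc]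
  change (P * (b * g * c) * Q).rank ≤ (P * g * Q).rank
  rw [h]
  exact (Matrix.rank_mul_le_left _ _).trans (Matrix.rank_mul_le_right _ _)

theorem cornerRank_mul (g : GL (Fin n) ℂ) {b c : GL (Fin n) ℂ} (hb : b ∈ borelSubgroup n)
    (hc : c ∈ borelSubgroup n) (i j : Fin n) :
    cornerRank (b * g * c).val i j = cornerRank g.val i j := by
  refine le_antisymm (cornerRank_mul_le g.val hb hc i j) ?_
  have := cornerRank_mul_le (b * g * c).val ((borelSubgroup n).inv_mem hb)
    ((borelSubgroup n).inv_mem hc) i j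
  rwa [← Units.val_mul, ← Units.val_mul, show b⁻¹ * (b * g * c) * c⁻¹ = g by group] at this

theorem cornerRank_permGL (π : Equiv.Perm (Fin n)) (i j : Fin n) :
    cornerRank (permGL π).val i j = {k | i ≤ k ∧ π⁻¹ k ≤ j}.ncard := by
  have h : diagonal (fun k => if i ≤ k then (1 : ℂ) else 0) * (permGL π).val *
      diagonal (fun k => if k ≤ j then (1 : ℂ) else 0) =
      diagonal (fun k => if i ≤ k ∧ π⁻¹ k ≤ j then (1 : ℂ) else 0) * (permGL π).val := by
    ext k l
    have h1 : (permGL π).val = Matrix.of fun i j => if i = π j then 1 else 0 := rfl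
    rw [Matrix.mul_diagonal, Matrix.diagonal_mul, Matrix.diagonal_mul, h1, Matrix.of_apply]
    by_cases h2 : k = π l
    · subst h2
      by_cases h3 : i ≤ π l <;> by_cases h4 : l ≤ j <;> simp [h3, h4]
    · simp [h2]
  classical
  rw [cornerRank, h, Matrix.rank_mul_eq_left_of_isUnit_det _ _
    ((Matrix.isUnit_iff_isUnit_det _).1 (permGL π).isUnit), Matrix.rank_diagonal,
    ← Nat.card_coe_set_eq, Nat.card_eq_fintype_card]
  refine Fintype.card_congr (Equiv.subtypeEquivRight fun k => ?_)
  simp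

theorem cornerRank_permGL_injective {π π' : Equiv.Perm (Fin n)}
    (h : ∀ i j, cornerRank (permGL π).val i j = cornerRank (permGL π').val i j) : π = π' := by
  simp only [cornerRank_permGL] at h
  -- If π'⁻¹ k were larger while the two agree on all larger indices, the set counted for π' at the
  -- corner (k, π⁻¹ k) would be that for π without k.
  have aux : ∀ (π π' : Equiv.Perm (Fin n)) (k : Fin n), (∀ l, k < l → π⁻¹ l = π'⁻¹ l) →
      (∀ i j, {k | i ≤ k ∧ π⁻¹ k ≤ j}.ncard = {k | i ≤ k ∧ π'⁻¹ k ≤ j}.ncard) →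
      π'⁻¹ k ≤ π⁻¹ k := by
    intro π π' k hk h
    by_contra hlt
    refine (h k (π⁻¹ k)).not_gt (Set.ncard_lt_ncard ?_ (Set.toFinite _))
    refine ⟨fun l hl => ?_, fun hsub => hlt (hsub ⟨le_rfl, le_rfl⟩).2⟩
    rcases eq_or_lt_of_le hl.1 with rfl | h1
    · exact absurd hl.2 hlt
    · exact ⟨hl.1, by rw [hk l h1]; exact hl.2⟩
  have : ∀ k, π⁻¹ k = π'⁻¹ k := by
    intro k
    induction k using WellFoundedGT.induction with
    | ind k ih =>
      exact le_antisymm (aux π' π k (fun l hl => (ih l hl).symm) fun i j => (h i j).symm)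
        (aux π π' k ih h)
  exact inv_injective (Equiv.ext this)

theorem cornerRank_of_mem_schubertCell {a g : GL (Fin n) ℂ} {π : Equiv.Perm (Fin n)}
    (h : QuotientGroup.mk g ∈ schubertCell a π) (i j : Fin n) :
    cornerRank (a⁻¹ * g).val i j = cornerRank (permGL π).val i j := by
  obtain ⟨b, hb, he⟩ := h
  have hc := QuotientGroup.eq.1 he.symm
  rw [← cornerRank_mul (permGL π) hb hc]
  congr 2
  group

theorem isClosed_cornerRank_le (a : GL (Fin n) ℂ) (i j : Fin n) (r : ℕ) :
    IsClosed[(generalLinear n).top] {g | cornerRank (a⁻¹ * g).val i j ≤ r} := by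
  have hG := isGeometric_generalLinear n
  refine isClosed_rank_le hG (A := fun g => diagonal (fun k => if i ≤ k then (1 : ℂ) else 0) *
    (a⁻¹ * g).val * diagonal (fun k => if k ≤ j then (1 : ℂ) else 0)) (fun g k l => ?_) r
  refine hG.matrix_mul (A := fun g : GL (Fin n) ℂ =>
    diagonal (fun k => if i ≤ k then (1 : ℂ) else 0) * (a⁻¹ * g).val)
    (A' := fun _ => diagonal (fun k => if k ≤ j then (1 : ℂ) else 0))
    (fun k l => ?_) (fun k l => hG.const _ _) _ _
  refine hG.matrix_mul (A := fun _ => diagonal (fun k => if i ≤ k then (1 : ℂ) else 0))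
    (A' := fun g : GL (Fin n) ℂ => (a⁻¹ * g).val)
    (fun k l => hG.const _ _) (fun k l => ?_) _ _
  exact hG.matrix_mul (A := fun _ => (a⁻¹).val) (A' := fun g : GL (Fin n) ℂ => g.val)
    (fun k l => hG.const _ _) (fun k l => generalLinear_regularAt_apply g k l) _ _

/-- The union of the Schubert cells with corner ranks at most those of `π` is closed. -/
theorem isClosed_iUnion_schubertCell (a : GL (Fin n) ℂ) (π : Equiv.Perm (Fin n)) :
    IsClosed[(flagVariety n).top] (⋃ π' ∈ {π' : Equiv.Perm (Fin n) | ∀ i j,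
      cornerRank (permGL π').val i j ≤ cornerRank (permGL π).val i j}, schubertCell a π') := by
  let _ := (generalLinear n).top
  refine isClosed_coinduced.2 ?_
  have : (QuotientGroup.mk : _ → FlagSpace n) ⁻¹' (⋃ π' ∈ {π' : Equiv.Perm (Fin n) | ∀ i j,
      cornerRank (permGL π').val i j ≤ cornerRank (permGL π).val i j}, schubertCell a π') =
      ⋂ i, ⋂ j, {g | cornerRank (a⁻¹ * g).val i j ≤ cornerRank (permGL π).val i j} := by
    ext g
    simp only [Set.mem_preimage, Set.mem_iUnion, Set.mem_iInter, Set.mem_ofPred_eq, exists_prop]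
    constructor
    · rintro ⟨π', h1, h2⟩ i j
      rw [cornerRank_of_mem_schubertCell h2]
      exact h1 i j
    · intro h
      have h1 : (QuotientGroup.mk g : FlagSpace n) ∈ ⋃ π, schubertCell a π := by
        rw [iUnion_schubertCell]
        exact Set.mem_univ _
      obtain ⟨π', h2⟩ := Set.mem_iUnion.1 h1
      exact ⟨π', fun i j => by rw [← cornerRank_of_mem_schubertCell h2]; exact h i j, h2⟩
  rw [this]
  exact isClosed_iInter fun i => isClosed_iInter fun j => isClosed_cornerRank_le a i j _

/-- An ordering of `S_n` such that the Schubert cells of each initial segment form a closed set. -/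
theorem exists_closed_ordering (n : ℕ) : ∃ w : Fin n.factorial ≃ Equiv.Perm (Fin n),
    ∀ (a : GL (Fin n) ℂ) i, IsClosed[(flagVariety n).top] (⋃ j ≤ i, schubertCell a (w j)) := by
  -- If all corner ranks of π' are at most those of π and π' ≠ π, then the sum `R` strictly drops.
  -- Sorting by `R` thus places every such π' before π.
  let R : Equiv.Perm (Fin n) → ℕ := fun π => ∑ i, ∑ j, cornerRank (permGL π).val i j
  let e : Fin n.factorial ≃ Equiv.Perm (Fin n) :=
    (Fintype.equivFinOfCardEq (by rw [Fintype.card_perm, Fintype.card_fin])).symm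
  let w := (Tuple.sort (R ∘ e)).trans e
  have hw : Monotone (R ∘ w) := Tuple.monotone_sort (R ∘ e)
  refine ⟨w, fun a i => ?_⟩
  let _ := (flagVariety n).top
  have hlt : ∀ {π π' : Equiv.Perm (Fin n)},
      (∀ i j, cornerRank (permGL π').val i j ≤ cornerRank (permGL π).val i j) → π' ≠ π →
      R π' < R π := by
    intro π π' h hne
    have h1 : ∃ i j, cornerRank (permGL π').val i j ≠ cornerRank (permGL π).val i j := by
      by_contra h2
      push Not at h2
      exact hne (cornerRank_permGL_injective h2)
    obtain ⟨i, j, hij⟩ := h1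
    exact Finset.sum_lt_sum (fun i _ => Finset.sum_le_sum fun j _ => h i j)
      ⟨i, Finset.mem_univ _, Finset.sum_lt_sum (fun j _ => h i j)
        ⟨j, Finset.mem_univ _, lt_of_le_of_ne (h i j) hij⟩⟩
  have hunion : (⋃ j ≤ i, schubertCell a (w j)) =
      ⋃ j ∈ Set.Iic i, ⋃ π' ∈ {π' : Equiv.Perm (Fin n) | ∀ k l,
        cornerRank (permGL π').val k l ≤ cornerRank (permGL (w j)).val k l},
        schubertCell a π' := by
    ext z
    simp only [Set.mem_iUnion, exists_prop, Set.mem_Iic, Set.mem_ofPred_eq]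
    constructor
    · rintro ⟨j, hj, hz⟩
      exact ⟨j, hj, w j, fun _ _ => le_rfl, hz⟩
    · rintro ⟨j, hj, π', hπ', hz⟩
      by_cases hne : π' = w j
      · exact ⟨j, hj, hne ▸ hz⟩
      · refine ⟨w.symm π', ?_, by rwa [Equiv.apply_symm_apply]⟩
        by_contra hij
        have h1 := hw (hj.trans (not_le.1 hij).le)
        simp only [Function.comp_apply, Equiv.apply_symm_apply] at h1
        exact absurd (hlt hπ' hne) (not_lt.2 h1)
  rw [hunion]
  exact (Set.toFinite _).isClosed_biUnion fun j _ => isClosed_iUnion_schubertCell a (w j)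

end closure

/-! ## Existence of the normal form -/

section NormalForm

/-- `b` is a basis that the nilpotent map `f` maps to itself and zero, in echelon form with respect
to the ordering given by `ord`. -/
structure IsNilpotentBasis {V ι : Type} [AddCommGroup V] [Module ℂ V] (f : Module.End ℂ V)
    (ord : ι → ℕ) (b : Module.Basis ι ℂ V) : Prop where
  inj : Function.Injective ord
  image : ∀ j, f (b j) = 0 ∨ ∃ i, ord i < ord j ∧ f (b j) = b i
  unique : ∀ i j l, f (b j) = b i → f (b l) = b i → j = l
  echelon : ∀ i k l, ord i < ord k → f (b l) = b k → ∃ j, ord j < ord l ∧ f (b j) = b i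

/-- Cut a complement of W ⊓ K down to K. With K = ker f, a basis can be completed by vectors of the
kernel. -/
theorem exists_isCompl_le {V : Type} [AddCommGroup V] [Module ℂ V] {W K : Submodule ℂ V}
    (h : W ⊔ K = ⊤) : ∃ C ≤ K, IsCompl W C := by
  obtain ⟨D, hD⟩ := Submodule.exists_isCompl (W ⊓ K)
  refine ⟨D ⊓ K, inf_le_right, IsCompl.of_eq ?_ ?_⟩
  · rw [inf_comm D K, ← inf_assoc, hD.inf_eq_bot]
  · have h1 : (W ⊓ K) ⊔ D ⊓ K = K := by
      rw [← sup_inf_assoc_of_le D inf_le_right, hD.sup_eq_top, top_inf_eq]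
    rw [eq_top_iff, ← h]
    refine sup_le le_sup_left ?_
    conv_lhs => rw [← h1]
    exact sup_le_sup_right inf_le_left _

/-- Applying f to a relation and reading the coordinate at `e k` isolates the coefficient of `g k`,
since no `f (b j)` involves `b (e k)`. What remains is a relation among the `b i`. -/
theorem linearIndependent_extend {V ι κ : Type} [AddCommGroup V] [Module ℂ V] [Fintype ι]
    [Fintype κ] {f : Module.End ℂ V} (b : Module.Basis ι ℂ (LinearMap.range f)) (e : κ → ι)
    (he : Function.Injective e) (hb : ∀ j, f (b j) = 0 ∨ ∃ i, (∀ k, e k ≠ i) ∧ f (b j) = b i)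
    {g : κ → V} (hg : ∀ k, f (g k) = b (e k)) :
    LinearIndependent ℂ (Sum.elim (fun i => (b i : V)) g) := by
  classical
  rw [Fintype.linearIndependent_iff]
  intro c hc
  rw [Fintype.sum_sum_type] at hc
  simp only [Sum.elim_inl, Sum.elim_inr] at hc
  have hκ : ∀ k, c (Sum.inr k) = 0 := by
    intro k
    have h1 := congrArg (fun v => b.repr (f.rangeRestrict v) (e k)) hc
    simp only [map_add, map_sum, map_smul, Finsupp.coe_add, Pi.add_apply, Finsupp.finsetSum_apply,
      Finsupp.coe_smul, Pi.smul_apply, map_zero, Finsupp.coe_zero, Pi.zero_apply] at h1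
    rw [Finset.sum_eq_zero, zero_add, Finset.sum_eq_single k] at h1
    · have h2 : f.rangeRestrict (g k) = b (e k) := Subtype.ext (hg k)
      rwa [h2, b.repr_self, Finsupp.single_eq_same, smul_eq_mul, mul_one] at h1
    · intro k' _ hk'
      have h2 : f.rangeRestrict (g k') = b (e k') := Subtype.ext (hg k')
      rw [h2, b.repr_self, Finsupp.single_eq_of_ne (he.ne hk'.symm), smul_zero]
    · simp
    · intro j _
      rcases hb j with h0 | ⟨i, hi, h0⟩
      · have h2 : f.rangeRestrict (b j) = 0 := Subtype.ext h0
        rw [h2, map_zero, Finsupp.coe_zero, Pi.zero_apply, smul_zero]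
      · have h2 : f.rangeRestrict (b j) = b i := Subtype.ext h0
        rw [h2, b.repr_self, Finsupp.single_eq_of_ne (hi k), smul_zero]
  simp only [hκ, zero_smul, Finset.sum_const_zero, add_zero] at hc
  have hι : ∀ i, c (Sum.inl i) = 0 := by
    refine Fintype.linearIndependent_iff.1 b.linearIndependent (fun i => c (Sum.inl i)) ?_
    refine Subtype.ext ?_
    simpa using hc
  rintro (i | k)
  · exact hι i
  · exact hκ k

/-- Induction on the range of f: to a basis of the range add preimages of those basis vectors not
yet hit, then vectors of the kernel. The rows of f that are nonzero are then exactly those of the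
range, which come first. -/
theorem exists_nilpotentBasis (m : ℕ) : ∀ (V : Type) [AddCommGroup V] [Module ℂ V]
    [FiniteDimensional ℂ V] (f : Module.End ℂ V), f ^ m = 0 →
    ∃ (ι : Type) (_ : Fintype ι) (ord : ι → ℕ) (b : Module.Basis ι ℂ V),
      IsNilpotentBasis f ord b := by
  induction m with
  | zero =>
    intro V _ _ _ f hf
    have hsub : Subsingleton V := by
      refine subsingleton_of_forall_eq 0 fun v => ?_
      have := congrArg (fun g : Module.End ℂ V => g v) hf
      simpa using this
    exact ⟨Empty, inferInstance, Empty.elim, Module.Basis.empty V,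
      ⟨fun i => i.elim, fun i => i.elim, fun i => i.elim, fun i => i.elim⟩⟩
  | succ m ih =>
    intro V _ _ _ f hf
    classical
    let W := LinearMap.range f
    let h : Module.End ℂ W := f.restrict fun x _ => ⟨x, rfl⟩
    have hpow : ∀ (k : ℕ) (w : W), ((h ^ k) w : V) = (f ^ k) w := by
      intro k
      induction k with
      | zero => exact fun w => rfl
      | succ k ihk =>
        intro w
        rw [pow_succ, pow_succ, Module.End.mul_apply, Module.End.mul_apply, ihk]
        rfl
    have hh : h ^ m = 0 := by
      refine LinearMap.ext fun w => Subtype.ext ?_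
      obtain ⟨v, hv⟩ := w.2
      rw [hpow, ← hv, ← Module.End.mul_apply, ← pow_succ, hf]
      rfl
    obtain ⟨ι, _, ord, b, hb⟩ := ih W h hh
    have hval : ∀ {i j}, h (b j) = b i ↔ f (b j) = b i := fun {i j} => Subtype.ext_iff
    let κ := {i : ι // ∀ l, f (b l) ≠ b i}
    have hpre : ∀ k : κ, ∃ v, f v = b k.1 := fun k => (b k.1).2
    choose g hg using hpre
    have hli := linearIndependent_extend (f := f) b (fun k : κ => k.1) Subtype.val_injective
      (fun j => by
        rcases hb.image j with h0 | ⟨i, -, h0⟩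
        · exact Or.inl (congrArg Subtype.val h0)
        · exact Or.inr ⟨i, fun k hk => k.2 j (by rw [hk]; exact hval.1 h0), hval.1 h0⟩) hg
    set F : ι ⊕ κ → V := Sum.elim (fun i => (b i : V)) g with hF
    have hsup : Submodule.span ℂ (Set.range F) ⊔ LinearMap.ker f = ⊤ := by
      rw [← Submodule.comap_map_eq, eq_top_iff]
      intro v _
      rw [Submodule.mem_comap]
      have hb' : ∀ i, (b i : V) ∈ (Submodule.span ℂ (Set.range F)).map f := by
        intro i
        by_cases hi : ∃ l, f (b l) = b i
        · obtain ⟨l, hl⟩ := hi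
          exact ⟨b l, Submodule.subset_span ⟨Sum.inl l, rfl⟩, hl⟩
        · push Not at hi
          exact ⟨g ⟨i, hi⟩, Submodule.subset_span ⟨Sum.inr ⟨i, hi⟩, rfl⟩, hg _⟩
      have h1 := congrArg Subtype.val (b.sum_repr ⟨f v, v, rfl⟩)
      rw [← (show _ = f v from h1), Submodule.coe_sum]
      exact Submodule.sum_mem _ fun i _ => Submodule.smul_mem _ _ (hb' i)
    obtain ⟨C, hC, hcompl⟩ := exists_isCompl_le hsup
    let bC := Module.finBasis ℂ C
    let b' : Module.Basis ((ι ⊕ κ) ⊕ Fin (Module.finrank ℂ C)) ℂ V :=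
      ((Module.Basis.span hli).prod bC).map (Submodule.prodEquivOfIsCompl _ _ hcompl)
    have hb1 : ∀ i, b' (Sum.inl (Sum.inl i)) = b i := by
      intro i
      simp [b', hF]
    have hb2 : ∀ k, b' (Sum.inl (Sum.inr k)) = g k := by
      intro k
      simp [b', hF]
    have hb3 : ∀ x, f (b' (Sum.inr x)) = 0 := by
      intro x
      have : b' (Sum.inr x) = bC x := by simp [b']
      rw [this]
      exact hC (bC x).2
    obtain ⟨B, hB⟩ := (Set.finite_range ord).bddAbove
    have hB' : ∀ i, ord i ≤ B := fun i => hB ⟨i, rfl⟩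
    -- The range comes first, then the preimages in the order of their images, then the kernel
    -- vectors. The shifts by B + 1 keep the three groups apart.
    let ord' : (ι ⊕ κ) ⊕ Fin (Module.finrank ℂ C) → ℕ :=
      Sum.elim (Sum.elim ord fun k => B + 1 + ord k.1) fun x => B + 1 + (B + 1) + x
    have inl_of_eq : ∀ x y, f (b' x) = b' y → ∃ i, y = Sum.inl (Sum.inl i) := by
      have key : ∀ i y, (b i : V) = b' y → y = Sum.inl (Sum.inl i) := fun i y hy =>
        b'.injective (by rw [← hy, hb1])
      rintro ((j | k) | x) y hy
      · rw [hb1] at hy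
        rcases hb.image j with h0 | ⟨i, -, h0⟩
        · have h1 : f (b j) = 0 := congrArg Subtype.val h0
          exact absurd (hy.symm.trans h1) (b'.ne_zero y)
        · exact ⟨i, key i y ((hval.1 h0).symm.trans hy)⟩
      · rw [hb2, hg] at hy
        exact ⟨_, key _ y hy⟩
      · rw [hb3] at hy
        exact absurd hy.symm (b'.ne_zero y)
    refine ⟨_, inferInstance, ord', b', ⟨?_, ?_, ?_, ?_⟩⟩
    · rintro ((i | k) | x) ((i' | k') | x') hxy <;>
        simp only [ord', Sum.elim_inl, Sum.elim_inr] at hxy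
      · rw [hb.inj hxy]
      · have := hB' i
        omega
      · have := hB' i
        omega
      · have := hB' i'
        omega
      · rw [Subtype.ext (hb.inj (Nat.add_left_cancel hxy))]
      · have := hB' k.1
        omega
      · have := hB' i'
        omega
      · have := hB' k'.1
        omega
      · rw [Fin.ext (Nat.add_left_cancel hxy)]
    · rintro ((j | k) | x)
      · rcases hb.image j with h0 | ⟨i, hi, h0⟩
        · exact Or.inl (by rw [hb1]; exact congrArg Subtype.val h0)
        · exact Or.inr ⟨Sum.inl (Sum.inl i), hi, by rw [hb1, hb1]; exact hval.1 h0⟩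
      · refine Or.inr ⟨Sum.inl (Sum.inl k.1), ?_, by rw [hb2, hb1, hg]⟩
        have := hB' k.1
        simp only [ord', Sum.elim_inl, Sum.elim_inr]
        omega
      · exact Or.inl (hb3 x)
    · intro i j l hj hl
      obtain ⟨i, rfl⟩ := inl_of_eq _ _ hj
      rw [hb1] at hj hl
      obtain ((j | k) | x) := j <;> obtain ((l | k') | x') := l <;>
        simp only [hb1, hb2, hb3, hg] at hj hl
      · rw [hb.unique i j l (hval.2 hj) (hval.2 hl)]
      · exact absurd (hj.trans hl.symm) (k'.2 j)
      · exact absurd (Subtype.ext hl.symm) (b.ne_zero i)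
      · exact absurd (hl.trans hj.symm) (k.2 l)
      · rw [Subtype.ext (b.injective (Subtype.ext (hj.trans hl.symm)))]
      · exact absurd (Subtype.ext hl.symm) (b.ne_zero i)
      all_goals exact absurd (Subtype.ext hj.symm) (b.ne_zero i)
    · intro i y l hiy hl
      obtain ⟨k, rfl⟩ := inl_of_eq _ _ hl
      obtain ((i | i) | x) := i
      · have hik : ord i < ord k := hiy
        rw [hb1] at hl ⊢
        obtain ((l | l) | x) := l
        · rw [hb1] at hl
          obtain ⟨j, hj, h0⟩ := hb.echelon i k l hik (hval.2 hl)
          exact ⟨Sum.inl (Sum.inl j), hj, by rw [hb1]; exact hval.1 h0⟩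
        · rw [hb2, hg] at hl
          have hlk : l.1 = k := b.injective (Subtype.ext hl)
          -- Either the earlier vector b_i is hit from within the range, which precedes all added
          -- preimages, or it has its own preimage, placed before that of b_k.
          by_cases hi : ∃ j, f (b j) = b i
          · obtain ⟨j, hj⟩ := hi
            refine ⟨Sum.inl (Sum.inl j), ?_, by rwa [hb1]⟩
            have := hB' j
            simp only [ord', Sum.elim_inl, Sum.elim_inr]
            omega
          · push Not at hi
            refine ⟨Sum.inl (Sum.inr ⟨i, hi⟩), ?_, by rw [hb2, hg]⟩
            simp only [ord', Sum.elim_inl, Sum.elim_inr, hlk]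
            omega
        · rw [hb3] at hl
          exact absurd (Subtype.ext hl.symm) (b.ne_zero k)
      · have := hB' k
        simp only [ord', Sum.elim_inl, Sum.elim_inr] at hiy
        omega
      · have := hB' k
        simp only [ord', Sum.elim_inl, Sum.elim_inr] at hiy
        omega

end NormalForm

/-! ### Assembling the generalized eigenspaces -/

section Jordan

variable {n : ℕ}

/-- Every endomorphism has a basis in which it is in normal form. -/
theorem exists_normalForm_basis (f : Module.End ℂ (Fin n → ℂ)) :
    ∃ (b : Module.Basis (Fin n) ℂ (Fin n → ℂ)) (s : Fin n → ℂ) (N : Matrix (Fin n) (Fin n) ℂ),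
      IsNormalForm s N ∧ ∀ j, f (b j) = s j • b j + ∑ i, N i j • b i := by
  classical
  let A : ℂ → Submodule ℂ (Fin n → ℂ) := f.maxGenEigenspace
  have hA : DirectSum.IsInternal A := DirectSum.isInternal_submodule_of_iSupIndep_of_iSup_eq_top
    f.independent_maxGenEigenspace (Module.End.iSup_maxGenEigenspace_eq_top f)
  have hmaps : ∀ μ, Set.MapsTo (f - algebraMap ℂ (Module.End ℂ (Fin n → ℂ)) μ) (A μ) (A μ) :=
    fun μ => Module.End.mapsTo_maxGenEigenspace_of_comm
      (Algebra.mul_sub_algebraMap_commutes f μ) μ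
  let g : ∀ μ, Module.End ℂ (A μ) := fun μ =>
    (f - algebraMap ℂ (Module.End ℂ (Fin n → ℂ)) μ).restrict (hmaps μ)
  have hex : ∀ μ, ∃ (ι : Type) (_ : Fintype ι) (ord : ι → ℕ) (b : Module.Basis ι ℂ (A μ)),
      IsNilpotentBasis (g μ) ord b := by
    intro μ
    obtain ⟨m, hm⟩ := f.isNilpotent_restrict_maxGenEigenspace_sub_algebraMap μ (hmaps μ)
    exact exists_nilpotentBasis m (A μ) (g μ) hm
  choose ι hfin ord v hv using hex
  let B := hA.collectedBasis v
  have hB : ∀ x : Σ μ, ι μ, B x = (v x.1 x.2 : Fin n → ℂ) := fun x => by simp [B]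
  let _ : Fintype (Σ μ, ι μ) := FiniteDimensional.fintypeBasisIndex B
  -- The embedding into cardinals is only an arbitrary linear order on ℂ. The lexicographic order
  -- makes equal eigenvalues adjacent.
  let key : (Σ μ, ι μ) → Cardinal.{0} ×ₗ ℕ := fun x => toLex (embeddingToCardinal x.1, ord x.1 x.2)
  have hkey : Function.Injective key := by
    rintro ⟨μ, i⟩ ⟨μ', i'⟩ h
    have h1 := Prod.mk.inj (toLex.injective h)
    obtain rfl := embeddingToCardinal.injective h1.1
    exact Sigma.ext rfl (heq_of_eq ((hv μ).inj h1.2))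
  let _ : LinearOrder (Σ μ, ι μ) := LinearOrder.lift' key hkey
  have hlt : ∀ {x y : Σ μ, ι μ}, x < y ↔ key x < key y := Iff.rfl
  have hle : ∀ {x y : Σ μ, ι μ}, x ≤ y → embeddingToCardinal x.1 ≤ embeddingToCardinal y.1 := by
    intro x y h
    have h1 : key x ≤ key y := h
    rcases Prod.Lex.toLex_le_toLex.1 h1 with h2 | h2
    · exact h2.le
    · exact h2.1.le
  have hlt' : ∀ {μ} {i j : ι μ}, (⟨μ, i⟩ : Σ μ, ι μ) < ⟨μ, j⟩ ↔ ord μ i < ord μ j := by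
    intro μ i j
    rw [hlt, Prod.Lex.toLex_lt_toLex]
    simp
  have hcard : Fintype.card (Σ μ, ι μ) = n := by
    rw [← Module.finrank_eq_card_basis B, Module.finrank_fin_fun]
  let o := Fintype.orderIsoFinOfCardEq (Σ μ, ι μ) hcard
  have hgB : ∀ {μ} {i j : ι μ}, g μ (v μ j) = v μ i ↔ f (B ⟨μ, j⟩) - μ • B ⟨μ, j⟩ = B ⟨μ, i⟩ := by
    intro μ i j
    rw [hB, hB, Subtype.ext_iff]
    rfl
  have hgB0 : ∀ {μ} {j : ι μ}, g μ (v μ j) = 0 ↔ f (B ⟨μ, j⟩) - μ • B ⟨μ, j⟩ = 0 := by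
    intro μ j
    rw [hB, Subtype.ext_iff]
    rfl
  let N' : (Σ μ, ι μ) → (Σ μ, ι μ) → Prop := fun x y => f (B y) - y.1 • B y = B x
  have hN' : ∀ {x y}, N' x y → ∃ μ i j, x = ⟨μ, i⟩ ∧ y = ⟨μ, j⟩ ∧ g μ (v μ j) = v μ i := by
    rintro x ⟨μ, j⟩ h
    rcases (hv μ).image j with h0 | ⟨i, -, h0⟩
    · exact absurd ((show f (B ⟨μ, j⟩) - μ • B ⟨μ, j⟩ = B x from h).symm.trans (hgB0.1 h0))
        (B.ne_zero x)
    · exact ⟨μ, i, j, B.injective (h.symm.trans (hgB.1 h0)), rfl, h0⟩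
  let s : Fin n → ℂ := fun i => (o i).1
  let N : Matrix (Fin n) (Fin n) ℂ := Matrix.of fun i j => if N' (o i) (o j) then 1 else 0
  have hN : ∀ {i j}, N i j ≠ 0 ↔ N' (o i) (o j) := by
    intro i j
    simp [N]
  refine ⟨B.reindex o.symm.toEquiv, s, N, ⟨?_, ?_, ?_, ?_, ?_⟩, ?_⟩
  · intro i j k hij hjk h
    refine embeddingToCardinal.injective (le_antisymm (hle (o.monotone hij)) ?_)
    have := hle (o.monotone hjk)
    rwa [← show (o i).1 = (o k).1 from h] at this
  · intro i j h
    obtain ⟨μ, a, c, h1, h2, -⟩ := hN' (hN.1 h)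
    simp only [s, h1, h2]
  · intro i j h
    obtain ⟨μ, a, c, h1, h2, h3⟩ := hN' (hN.1 h)
    rw [← o.lt_iff_lt, h1, h2, hlt']
    rcases (hv μ).image c with h0 | ⟨i, hi, h0⟩
    · exact absurd (h3.symm.trans h0) ((v μ).ne_zero a)
    · rwa [(v μ).injective (h3.symm.trans h0)]
  · intro i j j' h h'
    obtain ⟨μ, a, c, h1, h2, h3⟩ := hN' (hN.1 h)
    obtain ⟨μ', a', c', h1', h2', h3'⟩ := hN' (hN.1 h')
    rw [h1] at h1'
    obtain ⟨rfl, h4⟩ := Sigma.mk.inj_iff.1 h1'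
    obtain rfl := eq_of_heq h4
    apply o.injective
    rw [h2, h2', (hv μ).unique a c c' h3 h3']
  · intro i k l hik hs h
    obtain ⟨μ, a, c, h1, h2, h3⟩ := hN' (hN.1 h)
    obtain ⟨μ', d, h4⟩ : ∃ μ' d, o i = ⟨μ', d⟩ := ⟨_, _, rfl⟩
    have hμ : μ' = μ := by
      have : (o i).1 = (o k).1 := hs
      rwa [h1, h4] at this
    subst hμ
    rw [← o.lt_iff_lt, h1, h4, hlt'] at hik
    obtain ⟨j, hj, h5⟩ := (hv μ').echelon d a c hik h3
    refine ⟨o.symm ⟨μ', j⟩, ?_, hN.2 ?_⟩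
    · rw [← o.lt_iff_lt, o.apply_symm_apply, h2, hlt']
      exact hj
    · rw [o.apply_symm_apply, h4]
      exact hgB.1 h5
  · intro j
    have hre : ∀ i, B.reindex o.symm.toEquiv i = B (o i) := fun i => by simp
    simp only [hre]
    rw [← sub_eq_iff_eq_add']
    by_cases h : ∃ i, N' (o i) (o j)
    · obtain ⟨i, hi⟩ := h
      rw [Finset.sum_eq_single i]
      · simp only [N, Matrix.of_apply, if_pos hi, one_smul]
        exact hi
      · intro i' _ hi'
        rw [not_not.1 (mt hN.1 fun h' => hi' (o.injective (B.injective (h'.symm.trans hi)))),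
          zero_smul]
      · simp
    · rw [Finset.sum_eq_zero]
      · rcases (hv (o j).1).image (o j).2 with h0 | ⟨i, -, h0⟩
        · exact hgB0.1 h0
        · exact absurd ⟨o.symm ⟨_, i⟩, by rw [o.apply_symm_apply]; exact hgB.1 h0⟩ h
      · intro i _
        rw [not_not.1 (mt hN.1 fun h' => h ⟨i, h'⟩), zero_smul]

theorem exists_normalForm (M : Matrix (Fin n) (Fin n) ℂ) :
    ∃ (a : GL (Fin n) ℂ) (s : Fin n → ℂ) (N : Matrix (Fin n) (Fin n) ℂ),
      IsNormalForm s N ∧ Ad a⁻¹ M = diagonal s + N := by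
  obtain ⟨b, s, N, h, hb⟩ := exists_normalForm_basis (Matrix.toLin' M)
  have hdet : (Matrix.of fun i j => b j i).det ≠ 0 := by
    have h1 : (Matrix.of fun i j => b j i) = (Pi.basisFun ℂ (Fin n)).toMatrix b := by
      ext i j
      simp [Module.Basis.toMatrix_apply]
    rw [h1]
    let _ := (Pi.basisFun ℂ (Fin n)).invertibleToMatrix b
    exact (Matrix.isUnit_det_of_invertible _).ne_zero
  let a : GL (Fin n) ℂ := Matrix.GeneralLinearGroup.mkOfDetNeZero _ hdet
  have ha : a.val = Matrix.of fun i j => b j i := rfl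
  refine ⟨a, s, N, h, ?_⟩
  have hMa : M * a.val = a.val * (diagonal s + N) := by
    ext i j
    have h1 := congrFun (hb j) i
    rw [Matrix.toLin'_apply] at h1
    rw [mul_add, Matrix.add_apply, Matrix.mul_diagonal, ha]
    simp only [Pi.add_apply, Pi.smul_apply, Finset.sum_apply, smul_eq_mul] at h1
    rw [Matrix.mul_apply, Matrix.mul_apply]
    simp only [Matrix.of_apply]
    rw [show (∑ k, M i k * b j k) = (M *ᵥ b j) i from rfl, h1, mul_comm]
    simp only [mul_comm]
  rw [Ad, inv_inv, mul_assoc, hMa, ← mul_assoc, Units.inv_mul, one_mul]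

/-- The product of X - μ over the distinct diagonal entries μ is squarefree and annihilates the
matrix. -/
theorem isSemisimple_diagonal (s : Fin n → ℂ) :
    Module.End.IsSemisimple (Matrix.toLin' (diagonal s)) := by
  classical
  let p : Polynomial ℂ := ∏ μ ∈ Finset.univ.image s, (Polynomial.X - Polynomial.C μ)
  have hp : Squarefree p := by
    refine (Polynomial.separable_prod' (fun x _ y _ hxy => ?_)
      fun x _ => Polynomial.separable_X_sub_C).squarefree
    exact Polynomial.isCoprime_X_sub_C_of_isUnit_sub (sub_ne_zero.2 hxy).isUnit
  refine Module.End.isSemisimple_of_squarefree_aeval_eq_zero hp ?_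
  refine (Pi.basisFun ℂ (Fin n)).ext fun i => ?_
  have hv : Module.End.HasEigenvector (Matrix.toLin' (diagonal s)) (s i)
      (Pi.basisFun ℂ (Fin n) i) := hasEigenvector_toLin'_diagonal s i
  rw [Module.End.aeval_apply_of_hasEigenvector hv, Polynomial.eval_prod,
    Finset.prod_eq_zero (Finset.mem_image_of_mem s (Finset.mem_univ i)) (by simp), zero_smul,
    LinearMap.zero_apply]

theorem IsNormalForm.isNilpotent {s : Fin n → ℂ} {N : Matrix (Fin n) (Fin n) ℂ}
    (h : IsNormalForm s N) : IsNilpotent N := by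
  have hN : N.BlockTriangular id := by
    intro i j hij
    by_contra h0
    exact absurd (h.lt h0) (not_lt.2 (le_of_lt hij))
  have hN0 : ∀ i, N i i = 0 := fun i => by_contra fun h0 => (h.lt h0).ne rfl
  refine ⟨n, ?_⟩
  have h1 := Matrix.aeval_self_charpoly N
  rw [Matrix.charpoly_of_isUpperTriangular N hN] at h1
  simpa [hN0] using h1

theorem IsNormalForm.isSemisimplePart {s : Fin n → ℂ} {N : Matrix (Fin n) (Fin n) ℂ}
    (h : IsNormalForm s N) : IsSemisimplePart (diagonal s) (diagonal s + N) := by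
  refine ⟨isSemisimple_diagonal s, ?_, ?_⟩
  · rw [add_sub_cancel_left]
    exact h.isNilpotent
  · rw [add_sub_cancel_left, commute_iff_eq]
    ext i j
    rw [Matrix.mul_diagonal, Matrix.diagonal_mul, mul_comm]
    by_cases h0 : N i j = 0
    · rw [h0, zero_mul, zero_mul]
    · rw [h.eq h0]

end Jordan

end HessenbergPaving

/-! ### The paving theorem -/

theorem mainTheorem3 (n : ℕ) (M : (Fin n → ℂ) →ₗ[ℂ] (Fin n → ℂ)) :
    ∃ (a : GL (Fin n) ℂ) (M' s : Matrix (Fin n) (Fin n) ℂ)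
      (w : Fin n.factorial ≃ Equiv.Perm (Fin n)),
      M' = Ad a⁻¹ (LinearMap.toMatrix' M) ∧ M' ∈ borelAlgebra n ∧
      IsSemisimplePart s M' ∧ s.IsDiag ∧
      ∀ H : Submodule ℂ (Matrix (Fin n) (Fin n) ℂ), IsHessenbergSpace H →
        IsPavingByAffines (flagVariety n) (hessenbergVariety (LinearMap.toMatrix' M) H)
          (fun i : {i : Fin n.factorial //
              (schubertCell a (w i) ∩ hessenbergVariety (LinearMap.toMatrix' M) H).Nonempty} =>
            schubertCell a (w i) ∩ hessenbergVariety (LinearMap.toMatrix' M) H) ∧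
        ∀ π : Equiv.Perm (Fin n),
          ((schubertCell a π ∩ hessenbergVariety (LinearMap.toMatrix' M) H).Nonempty ↔
            Ad (permGL π)⁻¹ M' ∈ H) ∧
          ((schubertCell a π ∩ hessenbergVariety (LinearMap.toMatrix' M) H).Nonempty →
            ∃ d : ℕ,
              (d : ℤ) = (cellRoots π).ncard
                - (rootsOfSet ((fun u => Ad u (M' - s)) '' (cellUnipotents π ∩ leviGroup s))
                    ∩ complementRoots π H).ncard
                - (cellRoots π ∩ nilradicalRoots s ∩ complementRoots π H).ncard ∧
              Isomorphic
                ((flagVariety n).sub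
                  (schubertCell a π ∩ hessenbergVariety (LinearMap.toMatrix' M) H))
                (affineSpace (Fin d))) := by
  obtain ⟨a, s, N, hN, ha⟩ := exists_normalForm (LinearMap.toMatrix' M)
  obtain ⟨w, hw⟩ := exists_closed_ordering n
  refine ⟨a, diagonal s + N, diagonal s, w, ha.symm, hN.mem_borelAlgebra, hN.isSemisimplePart,
    Matrix.isDiag_diagonal s, fun H hH => ?_⟩
  set Y := hessenbergVariety (LinearMap.toMatrix' M) H with hY
  have hB : Ad a⁻¹ (LinearMap.toMatrix' M) ∈ borelAlgebra n := by
    rw [ha]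
    exact hN.mem_borelAlgebra
  have hvanish : ∀ {π : Equiv.Perm (Fin n)}, (schubertCell a π ∩ Y).Nonempty →
      ∀ p ∈ complementRoots π H, (diagonal s + N) p.1 p.2 = 0 := by
    rintro π ⟨z, hz, hzY⟩ p hp
    obtain ⟨x, rfl⟩ := mem_schubertCell.1 hz
    have h1 := (mk_cellGL_mem_hessenbergVariety hH hB x).1 hzY p hp
    rw [ha] at h1
    exact hN.apply_eq_zero_of_conj (isUpperUnipotent_cellMatrix x) (adjugate_mul_cellMatrix x)
      hp.1 h1
  have hcell : ∀ π : Equiv.Perm (Fin n), (schubertCell a π ∩ Y).Nonempty →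
      ∃ d : ℕ, (d : ℤ) = (cellRoots π).ncard
          - (rootsOfSet ((fun u => Ad u (diagonal s + N - diagonal s)) ''
              (cellUnipotents π ∩ leviGroup (diagonal s))) ∩ complementRoots π H).ncard
          - (cellRoots π ∩ nilradicalRoots (diagonal s) ∩ complementRoots π H).ncard ∧
        Isomorphic ((flagVariety n).sub (schubertCell a π ∩ Y)) (affineSpace (Fin d)) := by
    intro π hne
    have hC := hvanish hne
    obtain ⟨d, hd⟩ : ∃ d : ℕ, (cellRoots π).ncard =
        d + (pivotRoots (diagonal s + N) (complementRoots π H)).ncard := by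
      obtain ⟨D, -, hD, -⟩ := exists_parametrization hH hN.isEchelon hC
      have h1 := Set.ncard_add_ncard_compl D
      rw [Nat.card_coe_set_eq, hD] at h1
      exact ⟨Dᶜ.ncard, by omega⟩
    refine ⟨d, ?_, isomorphic_cell hH (by rw [ha]; exact hN.isEchelon) (by rwa [ha])
      (by rwa [ha])⟩
    have h1 := hN.ncard_pivotRoots hH hC
    rw [add_sub_cancel_left]
    omega
  refine ⟨⟨?_, ?_, fun i => ?_, fun i => ?_⟩, fun π => ⟨⟨fun h => ?_, fun h => ?_⟩, hcell π⟩⟩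
  · refine Set.Subset.antisymm (Set.iUnion_subset fun i => Set.inter_subset_right) fun z hz => ?_
    have h1 : z ∈ ⋃ π, schubertCell a π := by
      rw [iUnion_schubertCell]
      exact Set.mem_univ z
    obtain ⟨π, hπ⟩ := Set.mem_iUnion.1 h1
    have h2 : z ∈ schubertCell a (w (w.symm π)) ∩ Y := by
      rw [Equiv.apply_symm_apply]
      exact ⟨hπ, hz⟩
    exact Set.mem_iUnion.2 ⟨⟨w.symm π, z, h2⟩, h2⟩
  · intro i j hij
    refine (disjoint_schubertCell fun h => hij ?_).mono Set.inter_subset_left Set.inter_subset_left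
    exact Subtype.ext (w.injective h)
  -- The closed set is the union of all Schubert cells up to `i`; those that miss the Hessenberg
  -- variety contribute nothing to the intersection.
  · refine ⟨_, hw a i.1, ?_⟩
    ext z
    simp only [Set.mem_iUnion, Set.mem_inter_iff, exists_prop]
    constructor
    · rintro ⟨j, hj, hz, hzY⟩
      exact ⟨⟨j.1, hj, hz⟩, hzY⟩
    · rintro ⟨⟨j, hj, hz⟩, hzY⟩
      exact ⟨⟨j, z, hz, hzY⟩, hj, hz, hzY⟩
  · obtain ⟨d, -, hd⟩ := hcell (w i.1) i.2
    exact ⟨d, hd⟩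
  · exact (hH.Ad_permGL_inv_mem_iff hN.mem_borelAlgebra).2 (hvanish h)
  -- The coordinate flag aπB, corresponding to u = 1, is a point of the cell.
  · refine ⟨QuotientGroup.mk (a * permGL π), ⟨1, (borelSubgroup n).one_mem, by rw [mul_one]⟩, ?_⟩
    rw [hY, mk_mem_hessenbergVariety hH, _root_.mul_inv_rev, Ad_mul, ha]
    exact h
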